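/- Let $M$ be a compact smooth manifold with (possibly empty) boundary, let $V\to M$ be a smooth real vector bundle of finite rank with a fixed smooth metric, and let $T>0$. For each $t\in[0,T]$ let $g(t)$ be a Riemannian metric on $M$ with Levi-Civita connection $\nabla^{(t)}$, and let $D^{(t)}$ be a smooth connection on $V$ compatible with the metric of $V$. Write $D^2_{XX}f=D_XD_Xf-D_{\nabla_XX}f$; at time $t$ the operators $D,\nabla$ are $D^{(t)},\nabla^{(t)}$. For a closed set $S$ in a Euclidean space $W$ and $p\in S$, let $T^{\mathcal C}_pS$ be the set of $\xi\in W$ such that $\langle \xi,p-q\rangle\ge 0$ for every $q\notin S$ with $|q-p|=\operatorname{dist}(q,S)$. Let $\phi:V\to V$ be a fibre-preserving map which is locally Lipschitz along the fibres, i.e. every point of $V$ has a neighbourhood $U$ and a constant $L$ with $|\phi(u)-\phi(v)|\le L|u-v|$ whenever $u,v\in U$ lie in the same fibre. Let $C(t)\subset V$, $t\in[0,T]$, be closed subsets such that, writing $C_x(t)=C(t)\cap V_x$: * every $C_x(t)$ is non-empty and convex; * $C(t)$ is invariant under parallel transport of $D^{(t)}$ along smooth curves in $M$; * $C(t)$ is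 continuous in $t$ in the pointed Hausdorff sense: for all $t_0\in[0,T]$ and $R,\varepsilon>0$, if $t\in[0,T]$ is close enough to $t_0$ then for all $x\in M$ every $v\in C_x(t)$ with $|v|\le R$ has distance at most $\varepsilon$ from $C_x(t_0)$, and every $v\in C_x(t_0)$ with $|v|\le R$ has distance at most $\varepsilon$ from $C_x(t)$; * the family is preserved by the ODE $c'=\phi(c)$ in the fibres: if $0\le t_0\le t_1\le T$, $x\in M$ and $c:[t_0,t_1]\to V_x$ is a solution with $c(t_0)\in C_x(t_0)$, then $c(t_1)\in C_x(t_1)$. Let $f(x,t)$ be a family of sections of $V$, smooth on $M\times[0,T]$, and put $\mathcal D(t)=\max_{y\in M}\operatorname{dist}(f(y,t),C_y(t))$. For $x\in M$ let $v(x,t)$ be the point of $C_x(t)$ nearest to $f(x,t)$. Assume: 1. for every $t\in(0,T]$ with $\mathcal D(t)>0$ and every $x\in M$ with $\operatorname{dist}(f(x,t),C_x(t))=\mathcal D(t)$ there are integers $k,l\ge 0$ and smooth vector fields $X_1,\dots,X_k,Y_1,\dots,Y_l$ near $x$ such that, at $(x,t)$, $$\frac{\partial f}{\partial t}-\sum_{i=1}^kD^2_{X_iX_i}f-\sum_{j=1}^lD_{Y_j}f-\phi(f)\in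 T^{\mathcal C}_{v(x,t)}C_x(t);$$ 2. for every $(x,t)\in\partial M\times[0,T]$ with $\operatorname{dist}(f(x,t),C_x(t))=\mathcal D(t)>0$ one has $D_\nu f(x,t)\in T^{\mathcal C}_{v(x,t)}C_x(t)$, where $\nu$ is the exterior unit normal at $x$ with respect to $g(t)$. If $f(x,0)\in C_x(0)$ for all $x\in M$, then $f(x,t)\in C_x(t)$ for all $x\in M$ and all $t\in[0,T]$. -/

import Mathlib

open Bundle Set Filter Topology
open scoped Manifold ContDiff

noncomputable section

namespace TensorMaxPrinciple

/-! ### Convex geometry in a Euclidean vector space -/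

/-- The tangent cone of a closed set `S` at a point `p ∈ S`: all vectors `ξ` such that
`⟪ξ, p - q⟫ ≥ 0` for every `q ∉ S` having `p` as a nearest point in `S`. -/
def tangentCone {W : Type*} [NormedAddCommGroup W] [InnerProductSpace ℝ W]
    (S : Set W) (p : W) : Set W :=
  {ξ | ∀ q : W, q ∉ S → dist q p = Metric.infDist q S → 0 ≤ inner ℝ ξ (p - q)}

section Bundle

variable {E : Type*} [NormedAddCommGroup E] [NormedSpace ℝ E]
  {H : Type*} [TopologicalSpace H] {I : ModelWithCorners ℝ E H}
  {M : Type*} [TopologicalSpace M] [ChartedSpace H M]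
  {F : Type*} [NormedAddCommGroup F] [NormedSpace ℝ F]
  {V : M → Type*} [TopologicalSpace (TotalSpace F V)]
  [∀ x, NormedAddCommGroup (V x)] [∀ x, InnerProductSpace ℝ (V x)]
  [FiberBundle F V] [VectorBundle ℝ F V]

/-! ### Subsets of the total space of a vector bundle -/

/-- The part `S_x = S ∩ V_x` of a subset `S` of the total space in the fibre over `x`. -/
def fiber (S : Set (TotalSpace F V)) (x : M) : Set (V x) :=
  {v | TotalSpace.mk' F x v ∈ S}

/-- Continuity on `J`, in the pointed Hausdorff sense, of a family `C t` of subsets of the total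
space: as `t → t₀`, within any disc bundle of radius `R` the fibres of `C t` and of `C t₀` get
uniformly close to each other. -/
def PointedHausdorffContinuousOn (C : ℝ → Set (TotalSpace F V)) (J : Set ℝ) : Prop :=
  ∀ t₀ ∈ J, ∀ R > (0 : ℝ), ∀ ε > (0 : ℝ), ∀ᶠ t in 𝓝[J] t₀, ∀ x : M,
    (∀ v ∈ fiber (C t) x, ‖v‖ ≤ R → Metric.infDist v (fiber (C t₀) x) ≤ ε) ∧
    (∀ v ∈ fiber (C t₀) x, ‖v‖ ≤ R → Metric.infDist v (fiber (C t) x) ≤ ε)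

/-- A fibre-preserving map `φ : V → V` is locally Lipschitz along the fibres, locally uniformly on
the total space. -/
def FiberwiseLocallyLipschitz (F : Type*) [NormedAddCommGroup F] [NormedSpace ℝ F]
    {V : M → Type*} [TopologicalSpace (TotalSpace F V)] [∀ x, NormedAddCommGroup (V x)]
    (φ : ∀ x : M, V x → V x) : Prop :=
  ∀ p : TotalSpace F V, ∃ U ∈ 𝓝 p, ∃ L : ℝ, ∀ (x : M) (u v : V x),
    TotalSpace.mk' F x u ∈ U → TotalSpace.mk' F x v ∈ U →
      ‖φ x u - φ x v‖ ≤ L * ‖u - v‖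

/-- The family `C t`, `0 ≤ t ≤ T`, is preserved by the ordinary differential equation
`c' = φ(c)` in the fibres: a solution in `V_x` which is in `C_x(t₀)` at time `t₀` is in
`C_x(t₁)` at every later time `t₁`. -/
def PreservedByODE (φ : ∀ x : M, V x → V x) (C : ℝ → Set (TotalSpace F V)) (T : ℝ) : Prop :=
  ∀ (x : M) (t₀ t₁ : ℝ), 0 ≤ t₀ → t₀ ≤ t₁ → t₁ ≤ T → ∀ c : ℝ → V x,
    (∀ s ∈ Icc t₀ t₁, HasDerivWithinAt c (φ x (c s)) (Icc t₀ t₁) s) →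
      c t₀ ∈ fiber (C t₀) x → c t₁ ∈ fiber (C t₁) x

/-! ### Parallel transport -/

/-- The fibre coordinate at time `r` of a vector field `v` along a curve `γ`, in the preferred
local trivialization of the bundle near `x₀`. -/
def fiberCoord (x₀ : M) (γ : ℝ → M) (v : ∀ r, V (γ r)) (r : ℝ) : F :=
  (trivializationAt F V x₀ (TotalSpace.mk' F (γ r) (v r))).2

/-- The local section near `x₀` which has the constant value `w` in the preferred local
trivialization near `x₀`. -/
def constSection (x₀ : M) (w : F) (y : M) : V y :=
  (trivializationAt F V x₀).symm y w

/-- The covariant derivative at time `s ∈ J` of a vector field `v` along a curve `γ`. Writing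
`v(r) = ∑ vᵃ(r) e_a(γ(r))` in a local frame, it is `∑ (vᵃ)'(s) e_a + ∑ vᵃ(s) D_{γ'(s)} e_a`. -/
def covDerivAlong (D : CovariantDerivative I F V) (γ : ℝ → M) (v : ∀ r, V (γ r))
    (J : Set ℝ) (s : ℝ) : V (γ s) :=
  constSection (F := F) (γ s) (derivWithin (fiberCoord (F := F) (γ s) γ v) J s) (γ s) +
    D (constSection (F := F) (γ s) (fiberCoord (F := F) (γ s) γ v s)) (γ s)
      (mfderivWithin 𝓘(ℝ, ℝ) I γ J s (1 : ℝ))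

/-- The vector field `v` along `γ` is parallel on `J`. -/
def IsParallelOn (D : CovariantDerivative I F V) (γ : ℝ → M) (v : ∀ r, V (γ r))
    (J : Set ℝ) : Prop :=
  ∀ s ∈ J, DifferentiableWithinAt ℝ (fiberCoord (F := F) (γ s) γ v) J s ∧
    covDerivAlong D γ v J s = 0

/-- The subset `S` of the total space is invariant under parallel transport along smooth curves. -/
def ParallelInvariant (D : CovariantDerivative I F V) (S : Set (TotalSpace F V)) : Prop :=
  ∀ γ : ℝ → M, ContMDiffOn 𝓘(ℝ, ℝ) I ∞ γ (Icc 0 1) →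
    ∀ v : ∀ r, V (γ r), IsParallelOn D γ v (Icc 0 1) →
      v 0 ∈ fiber S (γ 0) → v 1 ∈ fiber S (γ 1)

/-! ### Riemannian metrics and second covariant derivatives -/

/-- `nabla` is the Levi-Civita connection of the Riemannian metric `g` on the tangent bundle: it
is torsion-free and compatible with `g`. -/
structure IsLeviCivita [IsManifold I ∞ M] [FiniteDimensional ℝ E] [CompleteSpace E]
    (g : ContMDiffRiemannianMetric I ∞ E (fun x : M => TangentSpace I x))
    (nabla : CovariantDerivative I E (fun x : M => TangentSpace I x)) : Prop where
  torsion_eq_zero : nabla.torsion = 0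
  compatible : ∀ (X Y Z : ∀ x : M, TangentSpace I x) (x : M),
    MDifferentiableAt I I.tangent (fun y => (⟨y, X y⟩ : TangentBundle I M)) x →
    MDifferentiableAt I I.tangent (fun y => (⟨y, Y y⟩ : TangentBundle I M)) x →
    MDifferentiableAt I I.tangent (fun y => (⟨y, Z y⟩ : TangentBundle I M)) x →
      mvfderiv I (fun y => g.inner y (Y y) (Z y)) x (X x) =
        g.inner x (nabla Y x (X x)) (Z x) + g.inner x (Y x) (nabla Z x (X x))

/-- The second covariant derivative `D²_{XX} f = D_X D_X f - D_{∇_X X} f` at `x`. -/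
def secondCovDeriv [IsManifold I ∞ M] (D : CovariantDerivative I F V)
    (nabla : CovariantDerivative I E (fun x : M => TangentSpace I x))
    (X : ∀ x : M, TangentSpace I x) (f : ∀ x : M, V x) (x : M) : V x :=
  D (fun y => D f y (X y)) x (X x) - D f x (nabla X x (X x))

end Bundle

/-! ### The exterior unit normal -/

/-- `ν` is the exterior unit normal at the boundary point `x` of a Riemannian manifold with
boundary. The zeroth coordinate `y ↦ (extChartAt _ x y) 0` is a boundary defining function near
`x`: it vanishes on the boundary, is positive in the interior, and has nonzero differential; so a
vector is tangent to the boundary iff this differential vanishes on it, and points outward iff it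
is negative on it. -/
structure IsExteriorUnitNormal {n : ℕ} [NeZero n] {M : Type*} [TopologicalSpace M]
    [ChartedSpace (EuclideanHalfSpace n) M] [IsManifold (𝓡∂ n) ∞ M]
    (g : ContMDiffRiemannianMetric (𝓡∂ n) ∞ (EuclideanSpace ℝ (Fin n))
      (fun x : M => TangentSpace (𝓡∂ n) x))
    (x : M) (ν : TangentSpace (𝓡∂ n) x) : Prop where
  unit : g.inner x ν ν = 1
  normal : ∀ w : TangentSpace (𝓡∂ n) x,
    mvfderiv (𝓡∂ n) (fun y : M => extChartAt (𝓡∂ n) x y 0) x w = 0 → g.inner x ν w = 0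
  exterior : mvfderiv (𝓡∂ n) (fun y : M => extChartAt (𝓡∂ n) x y 0) x ν < 0

end TensorMaxPrinciple

end

/-! Let `d(t,x)` be the distance of `f t x` from the fibre of `C t`, let `v` be a nearest point and
`n = f t x - v`. Neither `d` nor `v` need be differentiable, so every derivative is taken of a
smooth function that touches `d` suitably. Two opposite estimates of `⟪∂ₜf - φ(f), n⟫` collide at a
weighted maximum of `d`.

Space. Fix `t`, and let `x` be a spatial maximum of `d` with `d > 0`. Transport `n` parallel along a
chart line `γ` from `x` to a field `b`. Since `C t` is parallel invariant and `D` is metric, the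
half-space `⟪q, n⟫ ≤ ⟪v, n⟫`, which contains the convex fibre over `x`, is carried to half-spaces
containing the fibres along `γ`. Hence `⟪f, b⟫ - ⟪v, n⟫ ≤ |n| d ≤ |n|²` along `γ`, with equality at
`x`: the function `⟪f, b⟫` has a maximum at `x` (`IsAdapted.exists_transport_inner_le`). Its first
derivative is nonpositive in inward directions; in the interior, or by the boundary condition for
the exterior normal, `Df` is orthogonal to `n` (`inner_covDeriv_eq_zero_of_max`). The second
derivative test then gives `⟪D²_{XX}f, n⟫ ≤ 0` (`inner_secondCovDeriv_nonpos_of_max`), the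
connection of `M` dropping out. The cone condition turns this into `⟪∂ₜf - φ(f), n⟫ ≤ 0`.

Time. If `d(τ,x) ≤ (1 - k(t - τ)) d(t,x)` for earlier `τ`, then flowing the point nearest to `f τ x`
by `φ` from time `τ` to `t` lands in the fibre of `C t`, behind the supporting hyperplane at `v`.
Letting `τ → t` gives `⟪∂ₜf - φ(v), n⟫ ≥ k d²` (`mul_sq_le_inner_of_preserved`). With `L` a
Lipschitz constant of `φ` and `k > L` this contradicts the spatial estimate. Such a point arises by
maximizing `d` divided by an increasing affine function of time (`mem_fiber_of_inner_sub_nonpos`);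
the maximum exists because `d` is upper semicontinuous (`upperSemicontinuousWithinAt_infDist`). -/

section Abstract

/-! ### Ordinary differential equations and one-variable maxima -/

open Metric in
theorem IsPicardLindelof.exists_solution_mem_closedBall {E : Type*} [NormedAddCommGroup E]
    [NormedSpace ℝ E] [CompleteSpace E] {f : ℝ → E → E} {tmin tmax : ℝ} {t₀ : Icc tmin tmax}
    {x₀ x : E} {a r L K : NNReal} (hf : IsPicardLindelof f t₀ x₀ a r L K)
    (hx : x ∈ closedBall x₀ r) :
    ∃ α : ℝ → E, α t₀ = x ∧ ∀ t ∈ Icc tmin tmax, α t ∈ closedBall x₀ a ∧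
      HasDerivWithinAt α (f t (α t)) (Icc tmin tmax) t := by
  -- The curves in the domain of the Picard operator stay in the ball of radius `a` by construction;
  -- keeping this fact allows velocity bounds along the solution.
  obtain ⟨α, hα⟩ := ODE.FunSpace.exists_isFixedPt_next hf hx
  have hα' := (ODE.FunSpace.isFixedPt_next_iff hf hx).1 hα
  refine ⟨α.compProj, ?_, fun t ht => ⟨α.compProj_mem_closedBall hf.mul_max_le, ?_⟩⟩
  · rw [ODE.FunSpace.compProj_val, hα', ODE.picard_apply₀]
  · have hc : ContinuousOn (Function.uncurry f) (Icc tmin tmax ×ˢ closedBall x₀ a) :=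
      hf.continuousOn_uncurry
    refine (ODE.hasDerivWithinAt_picard_Icc t₀.2 hc α.continuous_compProj.continuousOn
      (fun t _ => α.compProj_mem_closedBall hf.mul_max_le) x ht).congr_of_mem ?_ ht
    intro s hs
    rw [← hα' ⟨s, hs⟩, ODE.FunSpace.compProj_of_mem hs]

/-- Solutions of an autonomous equation starting near `v` exist for a uniform time and, to first
order, move with velocity `φ v`. -/
theorem exists_uniform_flow {W : Type*} [NormedAddCommGroup W] [NormedSpace ℝ W] [CompleteSpace W]
    {φ : W → W} {v : W} {r : ℝ} (hr : 0 < r) {L : NNReal}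
    (hφ : LipschitzOnWith L φ (Metric.closedBall v r)) {ε : ℝ} (hε : 0 < ε) :
    ∃ h₀ > 0, ∃ ρ > 0, ∀ p ∈ Metric.closedBall v ρ, ∀ s₀ s₁ : ℝ, s₀ ≤ s₁ → s₁ ≤ s₀ + h₀ →
      ∃ c : ℝ → W, c s₀ = p ∧
        (∀ s ∈ Icc s₀ s₁, HasDerivWithinAt c (φ (c s)) (Icc s₀ s₁) s) ∧
        ‖c s₁ - p - (s₁ - s₀) • φ v‖ ≤ ε * (s₁ - s₀) := by
  -- On this radius the Lipschitz bound keeps `φ` within `ε` of `φ v`; `L + 1` avoids dividing by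
  -- zero.
  set r' : ℝ := min r (ε / (L + 1)) with hr'
  have hL0 : (0 : ℝ) < L + 1 := by positivity
  have hr'0 : 0 < r' := lt_min hr (by positivity)
  have hr'r : r' ≤ r := min_le_left _ _
  have hLr : L * r' ≤ ε := by
    have h1 : r' ≤ ε / (L + 1) := min_le_right _ _
    rw [le_div_iff₀ hL0] at h1
    nlinarith [L.2, hr'0]
  have hdiff : ∀ x ∈ Metric.closedBall v r', ‖φ x - φ v‖ ≤ ε := by
    intro x hx
    have h1 := hφ.norm_sub_le (Metric.closedBall_subset_closedBall hr'r hx)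
      (Metric.mem_closedBall_self hr.le)
    have h2 : ‖x - v‖ ≤ r' := mem_closedBall_iff_norm.1 hx
    exact h1.trans ((mul_le_mul_of_nonneg_left h2 L.2).trans hLr)
  set B : ℝ := ‖φ v‖ + ε with hB
  have hB0 : 0 < B := by positivity
  have hbd : ∀ x ∈ Metric.closedBall v r', ‖φ x‖ ≤ B := by
    intro x hx
    have := norm_le_norm_add_norm_sub' (φ x) (φ v)
    linarith [hdiff x hx]
  -- At speed at most `B`, a solution starting within `r' / 2` of `v` needs at least this time to
  -- leave the ball of radius `r'`.
  refine ⟨r' / 2 / B, by positivity, r' / 2, by positivity, fun p hp s₀ s₁ h01 h10 => ?_⟩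
  have hsub : Metric.closedBall p (r' / 2) ⊆ Metric.closedBall v r' := by
    apply Metric.closedBall_subset_closedBall'
    have := Metric.mem_closedBall.1 hp
    linarith
  have hPL : IsPicardLindelof (fun _ => φ) (tmin := s₀) (tmax := s₁) ⟨s₀, le_rfl, h01⟩ p
      ⟨r' / 2, by positivity⟩ 0 ⟨B, hB0.le⟩ L := by
    refine IsPicardLindelof.of_time_independent (fun x hx => hbd x (hsub hx))
      (hφ.mono (hsub.trans (Metric.closedBall_subset_closedBall hr'r))) ?_
    have h3 : s₁ - s₀ ≤ r' / 2 / B := by linarith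
    rw [le_div_iff₀ hB0] at h3
    have h4 : max (s₁ - s₀) (s₀ - s₀) = s₁ - s₀ := max_eq_left (by linarith)
    simp only [NNReal.coe_zero, sub_zero]
    rw [h4]
    change B * (s₁ - s₀) ≤ r' / 2
    linarith
  obtain ⟨c, hc0, hc⟩ := hPL.exists_solution_mem_closedBall (x := p) (by simp)
  refine ⟨c, hc0, fun s hs => (hc s hs).2, ?_⟩
  have hder : ∀ s ∈ Icc s₀ s₁,
      HasDerivWithinAt (fun s => c s - s • φ v) (φ (c s) - φ v) (Icc s₀ s₁) s := by
    intro s hs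
    simpa using (hc s hs).2.fun_sub ((hasDerivWithinAt_id s _).smul_const (φ v))
  have := (convex_Icc s₀ s₁).norm_image_sub_le_of_norm_hasDerivWithin_le hder
    (fun s hs => hdiff _ (hsub (hc s hs).1)) ⟨le_rfl, h01⟩ ⟨h01, le_rfl⟩
  rw [Real.norm_of_nonneg (sub_nonneg.2 h01)] at this
  have hc0' : c s₀ = p := hc0
  rw [hc0'] at this
  convert this using 2
  rw [sub_smul]; abel

/-- One-sided second derivative test at a maximum. -/
theorem nonpos_of_second_deriv_of_max {h h' : ℝ → ℝ} {h'' : ℝ}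
    (hmax : ∀ r ∈ Icc (0 : ℝ) 1, h r ≤ h 0)
    (hder : ∀ r ∈ Icc (0 : ℝ) 1, HasDerivWithinAt h (h' r) (Icc 0 1) r) (h0 : h' 0 = 0)
    (hder2 : HasDerivWithinAt h' h'' (Icc 0 1) 0) : h'' ≤ 0 := by
  by_contra hpos
  push Not at hpos
  have h1 := hasDerivWithinAt_iff_tendsto_slope.1 hder2
  have h2 : ∀ᶠ r in 𝓝[Icc (0 : ℝ) 1 \ {0}] 0, 0 < slope h' 0 r := h1.eventually (lt_mem_nhds hpos)
  rw [eventually_nhdsWithin_iff, Metric.eventually_nhds_iff] at h2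
  obtain ⟨ε, hε, h3⟩ := h2
  set δ := min (ε / 2) 1 with hδ
  have hδ0 : 0 < δ := lt_min (by positivity) one_pos
  have hpos' : ∀ r ∈ Ioo 0 δ, 0 < h' r := by
    intro r hr
    have hr1 : r < 1 := hr.2.trans_le (min_le_right _ _)
    have hr2 : r < ε / 2 := hr.2.trans_le (min_le_left _ _)
    have := h3 (y := r) (by rw [Real.dist_eq, sub_zero, abs_of_pos hr.1]; linarith)
      ⟨⟨hr.1.le, hr1.le⟩, by simpa using hr.1.ne'⟩
    rw [slope_def_field, h0, sub_zero, sub_zero] at this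
    exact (div_pos_iff_of_pos_right hr.1).1 this
  have hsub : Icc 0 δ ⊆ Icc (0 : ℝ) 1 := Icc_subset_Icc_right (min_le_right _ _)
  have hmono : StrictMonoOn h (Icc 0 δ) := by
    refine strictMonoOn_of_deriv_pos (convex_Icc 0 δ)
      (fun r hr => ((hder r (hsub hr)).continuousWithinAt.mono hsub)) fun r hr => ?_
    rw [interior_Icc] at hr
    rw [((hder r (hsub (Ioo_subset_Icc_self hr))).hasDerivAt (Icc_mem_nhds hr.1
      (hr.2.trans_le (min_le_right _ _)))).deriv]
    exact hpos' r hr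
  have := hmono ⟨le_rfl, hδ0.le⟩ ⟨hδ0.le, le_rfl⟩ hδ0
  linarith [hmax δ (hsub ⟨hδ0.le, le_rfl⟩)]

theorem nonpos_of_deriv_of_max {h : ℝ → ℝ} {h' : ℝ}
    (hmax : ∀ r ∈ Icc (0 : ℝ) 1, h r ≤ h 0)
    (hder : HasDerivWithinAt h h' (Icc 0 1) 0) : h' ≤ 0 := by
  have h1 := hasDerivWithinAt_iff_tendsto_slope.1 hder
  have hne : (𝓝[Icc (0 : ℝ) 1 \ {0}] 0).NeBot := by
    have h2 : Icc (0 : ℝ) 1 \ {0} = Ioc 0 1 := by simp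
    rw [h2, nhdsWithin_Ioc_eq_nhdsGT one_pos]
    infer_instance
  refine le_of_tendsto h1 ?_
  filter_upwards [self_mem_nhdsWithin] with r hr
  rw [slope_def_field, sub_zero]
  exact div_nonpos_of_nonpos_of_nonneg (by linarith [hmax r hr.1]) hr.1.1

/-! ### Nearest points of closed convex sets -/

/-! ### Nearest points and sets preserved by a flow -/

section Nearest

variable {W : Type*} [NormedAddCommGroup W] [InnerProductSpace ℝ W]

theorem inner_nearest_nonpos {S : Set W} (hS : Convex ℝ S) {u v : W} (hv : v ∈ S)
    (huv : dist u v = Metric.infDist u S) : ∀ q ∈ S, inner ℝ (u - v) (q - v) ≤ 0 := by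
  refine (norm_eq_iInf_iff_real_inner_le_zero hS hv).1 ?_
  rw [← dist_eq_norm, huv, Metric.infDist_eq_iInf]
  simp_rw [dist_eq_norm]

/-- The angle at `v` is not acute, so a point of the set that is almost as close to `u` as `v` is
must lie near `v`. -/
theorem norm_sub_sq_le_of_support {u v q : W} (h : inner ℝ (u - v) (q - v) ≤ 0) :
    ‖q - v‖ ^ 2 ≤ ‖u - q‖ ^ 2 - ‖u - v‖ ^ 2 := by
  have h1 : u - q = (u - v) - (q - v) := by abel
  have := norm_sub_sq_real (u - v) (q - v)
  rw [← h1] at this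
  linarith

/-- Suppose that closed sets `S τ` are carried into each other by the flow of `φ`, and that the
distance of `a τ` from `S τ` is at most `1 - k (t - τ)` times its value at time `t`. Then the
velocity of `a` relative to `φ` at the nearest point `v` points away from `S t` with speed at
least `k` times the distance. -/
theorem mul_sq_le_inner_of_preserved [ProperSpace W] {S : ℝ → Set W} {φ : W → W} {a : ℝ → W}
    {a' v : W} {t₀ t k : ℝ} (h0t : t₀ < t) (hk : 0 ≤ k)
    (hne : ∀ τ ∈ Icc t₀ t, (S τ).Nonempty) (hcl : ∀ τ ∈ Icc t₀ t, IsClosed (S τ))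
    (hv : ∀ q ∈ S t, inner ℝ (a t - v) (q - v) ≤ 0)
    (hd : dist (a t) v = Metric.infDist (a t) (S t))
    (ha : HasDerivWithinAt a a' (Icc t₀ t) t)
    (hcont : ∀ R > (0 : ℝ), ∀ ε > (0 : ℝ), ∀ᶠ τ in 𝓝[Icc t₀ t] t,
      ∀ p ∈ S τ, ‖p‖ ≤ R → Metric.infDist p (S t) ≤ ε)
    {r : ℝ} (hr : 0 < r) {L : NNReal} (hφ : LipschitzOnWith L φ (Metric.closedBall v r))
    (hode : ∀ τ ∈ Icc t₀ t, ∀ c : ℝ → W,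
      (∀ s ∈ Icc τ t, HasDerivWithinAt c (φ (c s)) (Icc τ t) s) → c τ ∈ S τ → c t ∈ S t)
    (hmax : ∀ τ ∈ Icc t₀ t, Metric.infDist (a τ) (S τ) ≤
      (1 - k * (t - τ)) * Metric.infDist (a t) (S t)) :
    k * dist (a t) v ^ 2 ≤ inner ℝ (a' - φ v) (a t - v) := by
  rw [← hd] at hmax
  have htt : t ∈ Icc t₀ t := ⟨h0t.le, le_rfl⟩
  rw [dist_eq_norm] at hmax hd ⊢
  set u := a t - v with hu
  set d := ‖u‖ with hdd
  have hd0 : 0 ≤ d := norm_nonneg _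
  refine le_of_forall_pos_le_add fun ε' hε' => ?_
  obtain ⟨ε, hε, hεd⟩ : ∃ ε > 0, 2 * ε * d ≤ ε' := by
    refine ⟨ε' / (2 * (d + 1)), by positivity, ?_⟩
    have : 2 * (ε' / (2 * (d + 1))) * d = ε' * (d / (d + 1)) := by field_simp
    rw [this]
    have h1 : d / (d + 1) ≤ 1 := by rw [div_le_one (by positivity)]; linarith
    nlinarith
  obtain ⟨h₀, hh₀, ρ, hρ, hflow⟩ := exists_uniform_flow hr hφ hε
  -- Chosen so that `(d + 2η)² - d² ≤ 4(d + 1)η ≤ (ρ / 2)²`, which with `norm_sub_sq_le_of_support`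
  -- puts the point `q` below within `ρ / 2` of `v`.
  set η : ℝ := min (min (ρ / 2) 1) (ρ ^ 2 / (16 * (d + 1))) with hη
  have hη0 : 0 < η := lt_min (lt_min (by positivity) one_pos) (by positivity)
  have hη1 : η ≤ ρ / 2 := (min_le_left _ _).trans (min_le_left _ _)
  have hη2 : η ≤ 1 := (min_le_left _ _).trans (min_le_right _ _)
  have hη3 : 16 * (d + 1) * η ≤ ρ ^ 2 := by
    have : η ≤ ρ ^ 2 / (16 * (d + 1)) := min_le_right _ _
    rw [le_div_iff₀ (by positivity)] at this
    linarith
  have e1 := hcont (‖a t‖ + 1 + d) (by positivity) η hη0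
  have e2 : ∀ᶠ τ in 𝓝[Icc t₀ t] t, ‖a τ - a t‖ ≤ η := by
    have := ha.continuousWithinAt.tendsto.eventually (Metric.closedBall_mem_nhds (a t) hη0)
    simpa [dist_eq_norm] using this
  have e3 : ∀ᶠ τ in 𝓝[Icc t₀ t] t, ‖a τ - a t - (τ - t) • a'‖ ≤ ε * ‖τ - t‖ :=
    (hasDerivWithinAt_iff_isLittleO.1 ha).def hε
  have e4 : ∀ᶠ τ in 𝓝[Icc t₀ t] t, t - h₀ < τ :=
    mem_nhdsWithin_of_mem_nhds (Ioi_mem_nhds (by linarith))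
  have hle : 𝓝[Ico t₀ t] t ≤ 𝓝[Icc t₀ t] t := nhdsWithin_mono _ Ico_subset_Icc_self
  have hnb : (𝓝[Ico t₀ t] t).NeBot := by
    rw [nhdsWithin_Ico_eq_nhdsLT h0t]; infer_instance
  obtain ⟨τ, ⟨⟨⟨h1, h2⟩, h3⟩, h4⟩, hτ⟩ :=
    (((((e1.and e2).and e3).and e4).filter_mono hle).and self_mem_nhdsWithin).exists
  have hτ' : τ ∈ Icc t₀ t := Ico_subset_Icc_self hτ
  have hh : 0 < t - τ := by linarith [hτ.2]
  obtain ⟨p, hpS, hp⟩ := (hcl τ hτ').exists_infDist_eq_dist (hne τ hτ') (a τ)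
  have hpd' : ‖a τ - p‖ ≤ (1 - k * (t - τ)) * d := by
    rw [← dist_eq_norm, ← hp]; exact hmax τ hτ'
  have hpd : ‖a τ - p‖ ≤ d := by
    refine hpd'.trans ?_
    nlinarith [mul_nonneg hk hh.le]
  have hpn : ‖p‖ ≤ ‖a t‖ + 1 + d := by
    have g1 : ‖p‖ ≤ ‖a τ‖ + ‖a τ - p‖ := by
      have := norm_sub_le (a τ) (a τ - p)
      rwa [sub_sub_cancel] at this
    have g2 := norm_le_norm_add_norm_sub' (a τ) (a t)
    linarith
  obtain ⟨q, hqS, hq⟩ := (hcl t htt).exists_infDist_eq_dist (hne t htt) p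
  have hpq : ‖p - q‖ ≤ η := by
    rw [← dist_eq_norm, ← hq]; exact h1 p hpS hpn
  have hqa : ‖a t - q‖ ≤ d + 2 * η := by
    have g : a t - q = -(a τ - a t) + (a τ - p) + (p - q) := by abel
    rw [g]
    refine (norm_add₃_le).trans ?_
    rw [norm_neg]
    linarith
  have hqv : ‖q - v‖ ≤ ρ / 2 := by
    have g1 := norm_sub_sq_le_of_support (hv q hqS)
    have g2 : ‖a t - q‖ ^ 2 ≤ (d + 2 * η) ^ 2 := by gcongr
    refine abs_le_of_sq_le_sq' ?_ (by positivity) |>.2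
    have g3 : ‖a t - v‖ = d := rfl
    rw [g3] at g1
    nlinarith
  have hpv : p ∈ Metric.closedBall v ρ := by
    rw [mem_closedBall_iff_norm]
    have : p - v = (p - q) + (q - v) := by abel
    rw [this]
    refine (norm_add_le _ _).trans (by linarith)
  obtain ⟨c, hc0, hc, hc1⟩ := hflow p hpv τ t hτ'.2 (by linarith)
  have hcS : c t ∈ S t := hode τ hτ' c hc (hc0 ▸ hpS)
  have k1 : inner ℝ (c t - v) u ≤ 0 := by
    rw [real_inner_comm]; exact hv _ hcS
  set e₁ := a τ - a t - (τ - t) • a' with he₁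
  set e₂ := c t - p - (t - τ) • φ v with he₂
  -- Paired with `u`, the first term is nonpositive by support, the second is at most `(1 - k (t -
  -- τ)) d²`, and the errors are at most `ε (t - τ) d` each. Cancelling `d²` and dividing by `t - τ`
  -- leaves the claim.
  have k2 : u = (c t - v) + (a τ - p) + (t - τ) • (a' - φ v) - e₁ - e₂ := by
    rw [he₁, he₂, hu]; module
  have k3 : d ^ 2 = inner ℝ (c t - v) u + inner ℝ (a τ - p) u
      + (t - τ) * inner ℝ (a' - φ v) u - inner ℝ e₁ u - inner ℝ e₂ u := by
    rw [hdd, ← real_inner_self_eq_norm_sq]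
    nth_rewrite 1 [k2]
    rw [inner_sub_left, inner_sub_left, inner_add_left, inner_add_left, real_inner_smul_left]
  have k4 : inner ℝ (a τ - p) u ≤ (1 - k * (t - τ)) * d * d :=
    (real_inner_le_norm _ _).trans (mul_le_mul_of_nonneg_right hpd' hd0)
  have hn : ‖τ - t‖ = t - τ := by rw [Real.norm_eq_abs, abs_sub_comm, abs_of_pos hh]
  rw [hn] at h3
  have k5 : -inner ℝ e₁ u ≤ ε * (t - τ) * d := by
    have := (abs_real_inner_le_norm e₁ u)
    have := mul_le_mul_of_nonneg_right h3 hd0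
    linarith [neg_abs_le (inner ℝ e₁ u)]
  have k6 : -inner ℝ e₂ u ≤ ε * (t - τ) * d := by
    have := (abs_real_inner_le_norm e₂ u)
    have := mul_le_mul_of_nonneg_right hc1 hd0
    linarith [neg_abs_le (inner ℝ e₂ u)]
  have k7 : (t - τ) * (k * d ^ 2) ≤ (t - τ) * (inner ℝ (a' - φ v) u + ε') := by
    nlinarith
  exact le_of_mul_le_mul_left k7 hh

end Nearest

end Abstract

noncomputable section

namespace TensorMaxPrinciple

/-! ### Uniform estimates in a Riemannian bundle over a compact base -/

section RiemannianBundle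

variable {M : Type*} [TopologicalSpace M]
  {F : Type*} [NormedAddCommGroup F] [NormedSpace ℝ F]
  {V : M → Type*} [TopologicalSpace (TotalSpace F V)]
  [∀ x, NormedAddCommGroup (V x)] [∀ x, InnerProductSpace ℝ (V x)]
  [FiberBundle F V]

omit [NormedSpace ℝ F] [∀ x, InnerProductSpace ℝ (V x)] in
theorem isClosed_fiber {S : Set (TotalSpace F V)} (hS : IsClosed S) (x : M) :
    IsClosed (fiber S x) :=
  hS.preimage (FiberBundle.continuous_totalSpaceMk F V x)

variable [VectorBundle ℝ F V]

variable (F) in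
theorem finiteDimensional_fiber [FiniteDimensional ℝ F] (x : M) : FiniteDimensional ℝ (V x) :=
  ((trivializationAt F V x).continuousLinearEquivAt ℝ x
    (mem_baseSet_trivializationAt F V x)).symm.toLinearEquiv.finiteDimensional

theorem continuousWithinAt_norm_sub [IsContinuousRiemannianBundle F V]
    {X : Type*} [TopologicalSpace X] {b : X → M} {u w : ∀ m, V (b m)} {s : Set X} {m₀ : X}
    (hu : ContinuousWithinAt (fun m => TotalSpace.mk' F (b m) (u m)) s m₀)
    (hw : ContinuousWithinAt (fun m => TotalSpace.mk' F (b m) (w m)) s m₀) :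
    ContinuousWithinAt (fun m => ‖u m - w m‖) s m₀ := by
  have h : (fun m => ‖u m - w m‖) = fun m => Real.sqrt
      (inner ℝ (u m) (u m) - 2 * inner ℝ (u m) (w m) + inner ℝ (w m) (w m)) := by
    funext m
    rw [real_inner_self_eq_norm_sq, real_inner_self_eq_norm_sq, ← norm_sub_sq_real,
      Real.sqrt_sq (norm_nonneg _)]
  rw [h]
  exact (((hu.inner_bundle hu).sub ((hu.inner_bundle hw).const_mul 2)).add
    (hw.inner_bundle hw)).sqrt

/-- The tube lemma; the restriction to `J` is moved into the predicate so that full neighbourhoods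
can be used. -/
theorem eventually_forall_of_eventually_prod [CompactSpace M] {J : Set ℝ} {t₀ : ℝ}
    {P : ℝ → M → Prop} (h : ∀ y, ∀ᶠ p : ℝ × M in 𝓝[J ×ˢ univ] (t₀, y), P p.1 p.2) :
    ∀ᶠ t in 𝓝[J] t₀, ∀ x, P t x := by
  have := (isCompact_univ (X := M)).eventually_forall_of_forall_eventually
    (x₀ := t₀) (P := fun t x => t ∈ J → P t x) (fun y _ => by
      have h1 := h y
      rw [eventually_nhdsWithin_iff] at h1
      filter_upwards [h1] with p hp hpJ using hp ⟨hpJ, mem_univ _⟩)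
  rw [eventually_nhdsWithin_iff]
  filter_upwards [this] with t ht htJ x using ht x (mem_univ _) htJ

variable [IsContinuousRiemannianBundle F V]

theorem eventually_forall_norm_sub_lt [CompactSpace M] {J : Set ℝ} {f : ℝ → ∀ x : M, V x}
    (hf : ContinuousOn (fun p : ℝ × M => TotalSpace.mk' F p.2 (f p.1 p.2)) (J ×ˢ univ))
    {t₀ : ℝ} (ht₀ : t₀ ∈ J) {ε : ℝ} (hε : 0 < ε) :
    ∀ᶠ t in 𝓝[J] t₀, ∀ x, ‖f t x - f t₀ x‖ < ε := by
  refine eventually_forall_of_eventually_prod (P := fun t x => ‖f t x - f t₀ x‖ < ε) fun y => ?_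
  have h1 := hf (t₀, y) ⟨ht₀, mem_univ _⟩
  have h2 : ContinuousWithinAt (fun p : ℝ × M => TotalSpace.mk' F p.2 (f t₀ p.2))
      (J ×ˢ univ) (t₀, y) := by
    refine ContinuousWithinAt.comp (f := fun p : ℝ × M => (t₀, p.2)) (x := (t₀, y)) h1
      (by fun_prop) ?_
    exact fun p _ => ⟨ht₀, mem_univ _⟩
  have h3 := (continuousWithinAt_norm_sub (F := F) (b := Prod.snd) h1 h2).tendsto
  simp only [sub_self, norm_zero] at h3
  exact h3.eventually (gt_mem_nhds hε)

/-- Every neighbourhood in the total space contains a tube of fixed radius in the fibre norms,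
because near `x₀` the trivialization has uniformly bounded operator norm on the fibres. -/
theorem exists_ball_subset_of_mem_nhds {σ : ∀ x : M, V x} {x₀ : M}
    (hσ : ContinuousAt (fun x => TotalSpace.mk' F x (σ x)) x₀) {U : Set (TotalSpace F V)}
    (hU : U ∈ 𝓝 (TotalSpace.mk' F x₀ (σ x₀))) :
    ∃ δ > 0, ∀ᶠ x in 𝓝 x₀, ∀ u : V x, ‖u - σ x‖ < δ → TotalSpace.mk' F x u ∈ U := by
  set e := trivializationAt F V x₀ with he
  have hx₀ : x₀ ∈ e.baseSet := mem_baseSet_trivializationAt F V x₀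
  have hsrc : TotalSpace.mk' F x₀ (σ x₀) ∈ e.source := by rwa [e.mem_source]
  have h1 : Tendsto e.toOpenPartialHomeomorph.symm (𝓝 (e (TotalSpace.mk' F x₀ (σ x₀))))
      (𝓝 (TotalSpace.mk' F x₀ (σ x₀))) := by
    have := e.toOpenPartialHomeomorph.continuousAt_symm
      (e.toOpenPartialHomeomorph.map_source hsrc)
    rw [ContinuousAt, e.toOpenPartialHomeomorph.left_inv hsrc] at this
    exact this
  have h2 := h1.eventually hU
  have h3 : e (TotalSpace.mk' F x₀ (σ x₀)) = (x₀, (e (TotalSpace.mk' F x₀ (σ x₀))).2) :=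
    Prod.ext (e.coe_fst hsrc) rfl
  rw [h3, nhds_prod_eq, eventually_prod_iff] at h2
  obtain ⟨pa, hpa, pb, hpb, hab⟩ := h2
  obtain ⟨r, hr, hball⟩ := Metric.eventually_nhds_iff.1 hpb
  obtain ⟨K, hK, hKe⟩ := eventually_norm_trivializationAt_lt F V x₀
  have h4 : ∀ᶠ x in 𝓝 x₀, dist (e (TotalSpace.mk' F x (σ x))).2
      (e (TotalSpace.mk' F x₀ (σ x₀))).2 < r / 2 := by
    have := ((e.continuousAt hsrc).comp (f := fun x => TotalSpace.mk' F x (σ x)) hσ).snd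
    exact this.tendsto.eventually (Metric.ball_mem_nhds _ (by positivity))
  refine ⟨r / 2 / K, by positivity, ?_⟩
  filter_upwards [hpa, hKe, h4, e.open_baseSet.mem_nhds hx₀] with x hxa hxK hx4 hxb u hu
  have hlin : ∀ w : V x, (e (TotalSpace.mk' F x w)).2 = e.continuousLinearMapAt ℝ x w := by
    intro w
    rw [Trivialization.continuousLinearMapAt_apply, e.coe_linearMapAt_of_mem hxb]
  have h5 : dist (e (TotalSpace.mk' F x u)).2 (e (TotalSpace.mk' F x (σ x))).2 < r / 2 := by
    rw [hlin, hlin, dist_eq_norm, ← map_sub]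
    refine (ContinuousLinearMap.le_opNorm _ _).trans_lt ?_
    rw [lt_div_iff₀ hK] at hu
    nlinarith [norm_nonneg (u - σ x)]
  have h6 := hab hxa (hball (lt_of_le_of_lt (dist_triangle _ _ _) (by linarith [h5, hx4])))
  have h7 : e (TotalSpace.mk' F x u) = (x, (e (TotalSpace.mk' F x u)).2) :=
    Prod.ext (e.coe_fst (by rwa [e.mem_source])) rfl
  rw [← h7] at h6
  have h8 := e.toOpenPartialHomeomorph.left_inv (x := TotalSpace.mk' F x u)
    (by simpa [e.mem_source] using hxb)
  have h9 : e.toOpenPartialHomeomorph.symm (e (TotalSpace.mk' F x u)) ∈ U := h6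
  change e.toOpenPartialHomeomorph.symm (e (TotalSpace.mk' F x u)) = _ at h8
  rwa [h8] at h9

/-- A fibrewise locally Lipschitz map is uniformly Lipschitz near a continuous section of a bundle
over a compact base. -/
theorem FiberwiseLocallyLipschitz.exists_lipschitzOnWith_ball [CompactSpace M]
    {φ : ∀ x : M, V x → V x} (hφ : FiberwiseLocallyLipschitz F φ) {σ : ∀ x : M, V x}
    (hσ : Continuous (fun x => TotalSpace.mk' F x (σ x))) :
    ∃ L : NNReal, ∃ δ > 0, ∀ x, LipschitzOnWith L (φ x) (Metric.ball (σ x) δ) := by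
  have hloc : ∀ x₀ : M, ∃ N ∈ 𝓝 x₀, ∃ L : NNReal, ∃ δ > 0, ∀ x ∈ N,
      LipschitzOnWith L (φ x) (Metric.ball (σ x) δ) := by
    intro x₀
    obtain ⟨U, hU, L, hL⟩ := hφ (TotalSpace.mk' F x₀ (σ x₀))
    obtain ⟨δ, hδ, h⟩ := exists_ball_subset_of_mem_nhds hσ.continuousAt hU
    refine ⟨_, h, L.toNNReal, δ, hδ, fun x hx => LipschitzOnWith.of_dist_le_mul ?_⟩
    intro u hu v hv
    rw [dist_eq_norm, dist_eq_norm]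
    refine (hL x u v (hx u (mem_ball_iff_norm.1 hu)) (hx v (mem_ball_iff_norm.1 hv))).trans ?_
    exact mul_le_mul_of_nonneg_right (Real.le_coe_toNNReal L) (norm_nonneg _)
  have key : ∃ L : NNReal, ∃ δ > 0, ∀ x ∈ (univ : Set M),
      LipschitzOnWith L (φ x) (Metric.ball (σ x) δ) := by
    refine isCompact_univ.induction_on
      (p := fun s => ∃ L : NNReal, ∃ δ > 0, ∀ x ∈ s, LipschitzOnWith L (φ x) (Metric.ball (σ x) δ))
      ⟨0, 1, one_pos, by simp⟩ ?_ ?_ ?_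
    · rintro s t hst ⟨L, δ, hδ, h⟩
      exact ⟨L, δ, hδ, fun x hx => h x (hst hx)⟩
    · rintro s t ⟨L, δ, hδ, h⟩ ⟨L', δ', hδ', h'⟩
      refine ⟨max L L', min δ δ', lt_min hδ hδ', ?_⟩
      rintro x (hx | hx)
      · exact ((h x hx).mono (Metric.ball_subset_ball (min_le_left _ _))).weaken (le_max_left _ _)
      · exact ((h' x hx).mono (Metric.ball_subset_ball (min_le_right _ _))).weaken
          (le_max_right _ _)
    · intro x _
      obtain ⟨N, hN, h⟩ := hloc x
      exact ⟨N, mem_nhdsWithin_of_mem_nhds hN, h⟩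
  obtain ⟨L, δ, hδ, h⟩ := key
  exact ⟨L, δ, hδ, fun x => h x (mem_univ x)⟩

end RiemannianBundle

/-! ### Covariant derivatives in trivializations and along curves -/

section Calculus

/-- A product `u w` with `u s = 0` is differentiable at `s` as soon as `u` is and `w` is
continuous. -/
theorem hasDerivWithinAt_mul_of_eq_zero {u w : ℝ → ℝ} {u' s : ℝ} {J : Set ℝ}
    (hu : HasDerivWithinAt u u' J s) (h0 : u s = 0) (hw : ContinuousWithinAt w J s) :
    HasDerivWithinAt (fun r => u r * w r) (u' * w s) J s := by
  rw [hasDerivWithinAt_iff_tendsto_slope] at hu ⊢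
  have h1 : (slope (fun r => u r * w r) s) = fun r => slope u s r * w r := by
    funext r
    simp only [slope_def_field, h0]
    ring
  rw [h1]
  exact hu.mul (hw.tendsto.mono_left (nhdsWithin_mono _ sdiff_subset))

end Calculus

section Coordinates

variable {M : Type*} [TopologicalSpace M]
  {F : Type*} [NormedAddCommGroup F] [NormedSpace ℝ F]
  {V : M → Type*} [TopologicalSpace (TotalSpace F V)]
  [∀ x, NormedAddCommGroup (V x)] [∀ x, InnerProductSpace ℝ (V x)]
  [FiberBundle F V] [VectorBundle ℝ F V]

variable (F) in
/-- The fibre coordinate at `y` in the preferred trivialization near `x₀`. -/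
def toCoord (x₀ y : M) : V y →L[ℝ] F := (trivializationAt F V x₀).continuousLinearMapAt ℝ y

/-- The vector at `y` with a given coordinate in the preferred trivialization near `x₀`. -/
def ofCoord (x₀ y : M) : F →L[ℝ] V y := (trivializationAt F V x₀).symmL ℝ y

theorem toCoord_apply {x₀ y : M} (hy : y ∈ (trivializationAt F V x₀).baseSet) (v : V y) :
    toCoord F x₀ y v = (trivializationAt F V x₀ (TotalSpace.mk' F y v)).2 := by
  rw [toCoord, Trivialization.continuousLinearMapAt_apply,
    (trivializationAt F V x₀).coe_linearMapAt_of_mem hy]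

theorem ofCoord_apply {x₀ y : M} (hy : y ∈ (trivializationAt F V x₀).baseSet) (w : F) :
    (ofCoord x₀ y w : V y) = (trivializationAt F V x₀).symm y w :=
  (trivializationAt F V x₀).symmL_apply hy w

theorem toCoord_ofCoord {x₀ y : M} (hy : y ∈ (trivializationAt F V x₀).baseSet) (w : F) :
    toCoord F x₀ y (ofCoord x₀ y w : V y) = w :=
  (trivializationAt F V x₀).continuousLinearMapAt_symmL hy w

theorem ofCoord_toCoord {x₀ y : M} (hy : y ∈ (trivializationAt F V x₀).baseSet) (v : V y) :
    ofCoord x₀ y (toCoord F x₀ y v) = v :=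
  (trivializationAt F V x₀).symmL_continuousLinearMapAt hy v

omit [NormedSpace ℝ F] [∀ x, InnerProductSpace ℝ (V x)] [VectorBundle ℝ F V] in
theorem eventually_mem_baseSet {x₀ y : M} (hy : y ∈ (trivializationAt F V x₀).baseSet) :
    ∀ᶠ y' in 𝓝 y, y' ∈ (trivializationAt F V x₀).baseSet :=
  (trivializationAt F V x₀).open_baseSet.mem_nhds hy

theorem continuousWithinAt_ofCoord {X : Type*} [TopologicalSpace X] {x₀ : M} {b : X → M}
    {n : X → F} {s : Set X} {m₀ : X} (hb : ContinuousWithinAt b s m₀)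
    (hn : ContinuousWithinAt n s m₀) (hm₀ : b m₀ ∈ (trivializationAt F V x₀).baseSet) :
    ContinuousWithinAt (fun m => TotalSpace.mk' F (b m) (ofCoord x₀ (b m) (n m) : V (b m)))
      s m₀ := by
  have h1 := ((trivializationAt F V x₀).continuousOn_symm (b m₀, n m₀) ⟨hm₀, mem_univ _⟩).continuousAt
    (((trivializationAt F V x₀).open_baseSet.prod isOpen_univ).mem_nhds ⟨hm₀, mem_univ _⟩)
  have h2 := ContinuousAt.comp_continuousWithinAt (f := fun m => (b m, n m)) (x := m₀) h1
    (hb.prodMk hn)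
  refine h2.congr_of_eventuallyEq ?_ ?_
  · filter_upwards [hb.tendsto.eventually (eventually_mem_baseSet hm₀)] with m hm
    simp only [Function.comp]
    rw [ofCoord_apply hm]
  · simp only [Function.comp]
    rw [ofCoord_apply hm₀]

end Coordinates

section Connection

variable {E : Type*} [NormedAddCommGroup E] [NormedSpace ℝ E]
  {H : Type*} [TopologicalSpace H] {I : ModelWithCorners ℝ E H}
  {M : Type*} [TopologicalSpace M] [ChartedSpace H M]
  {F : Type*} [NormedAddCommGroup F] [NormedSpace ℝ F]
  {V : M → Type*} [TopologicalSpace (TotalSpace F V)]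
  [∀ x, NormedAddCommGroup (V x)] [∀ x, InnerProductSpace ℝ (V x)]
  [FiberBundle F V] [VectorBundle ℝ F V]

theorem hasDerivWithinAt_comp_curve {G : Type*} [NormedAddCommGroup G] [NormedSpace ℝ G]
    {g : M → G} {γ : ℝ → M} {J : Set ℝ} {s : ℝ} (hg : MDifferentiableAt I 𝓘(ℝ, G) g (γ s))
    (hγ : MDifferentiableWithinAt 𝓘(ℝ, ℝ) I γ J s) :
    HasDerivWithinAt (fun r => g (γ r))
      (mvfderiv I g (γ s) (mfderivWithin 𝓘(ℝ, ℝ) I γ J s (1 : ℝ))) J s := by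
  have h1 : HasMFDerivWithinAt 𝓘(ℝ, ℝ) 𝓘(ℝ, G) (fun r => g (γ r)) J s _ :=
    hg.hasMFDerivAt.comp_hasMFDerivWithinAt s hγ.hasMFDerivWithinAt
  have h2 : HasFDerivWithinAt (fun r => g (γ r))
      ((mvfderiv I g (γ s)).comp (mfderivWithin 𝓘(ℝ, ℝ) I γ J s) : ℝ →L[ℝ] G) J s :=
    h1.hasFDerivWithinAt
  exact h2.hasDerivWithinAt

section Smooth

variable [ContMDiffVectorBundle 1 F V I]

theorem mdifferentiableAt_ofCoord {x₀ y : M} {n : M → F}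
    (hy : y ∈ (trivializationAt F V x₀).baseSet) (hn : MDifferentiableAt I 𝓘(ℝ, F) n y) :
    MDifferentiableAt I (I.prod 𝓘(ℝ, F))
      (fun y' => TotalSpace.mk' F y' (ofCoord x₀ y' (n y') : V y')) y := by
  rw [(trivializationAt F V x₀).mdifferentiableAt_section_iff I _ hy]
  refine hn.congr_of_eventuallyEq ?_
  filter_upwards [eventually_mem_baseSet hy] with y' hy'
  rw [← toCoord_apply hy', toCoord_ofCoord hy']

theorem mdifferentiableAt_toCoord {x₀ y : M} {σ : ∀ y, V y}
    (hy : y ∈ (trivializationAt F V x₀).baseSet)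
    (hσ : MDifferentiableAt I (I.prod 𝓘(ℝ, F)) (fun y' => TotalSpace.mk' F y' (σ y')) y) :
    MDifferentiableAt I 𝓘(ℝ, F) (fun y' => toCoord F x₀ y' (σ y')) y := by
  rw [(trivializationAt F V x₀).mdifferentiableAt_section_iff I _ hy] at hσ
  refine hσ.congr_of_eventuallyEq ?_
  filter_upwards [eventually_mem_baseSet hy] with y' hy'
  rw [← toCoord_apply hy']

/-- The covariant derivative of a section, in terms of the derivative of its coordinates and the
covariant derivative of the section with constant coordinates. -/
theorem covDeriv_eq [FiniteDimensional ℝ F] (D : CovariantDerivative I F V) {x₀ y : M}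
    {σ : ∀ y, V y} (hy : y ∈ (trivializationAt F V x₀).baseSet)
    (hσ : MDifferentiableAt I (I.prod 𝓘(ℝ, F)) (fun y' => TotalSpace.mk' F y' (σ y')) y)
    (X : TangentSpace I y) :
    D σ y X = ofCoord x₀ y (mvfderiv I (fun y' => toCoord F x₀ y' (σ y')) y X) +
      D (fun y' => ofCoord x₀ y' (toCoord F x₀ y (σ y))) y X := by
  -- Both terms have the same derivative part in the Leibniz rule, so their difference is tensorial
  -- and can be evaluated on the section with the same value and constant coordinates.
  set Φ : (∀ y, V y) → V y := fun σ =>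
    D σ y X - ofCoord x₀ y (mvfderiv I (fun y' => toCoord F x₀ y' (σ y')) y X) with hΦ
  have hten : TensorialAt I F Φ y := by
    constructor
    · intro g τ hg hτ
      have h1 : (fun y' => toCoord F x₀ y' ((g • τ) y')) =
          fun y' => g y' • toCoord F x₀ y' (τ y') := by
        funext y'; simp
      simp only [hΦ]
      rw [h1, mvfderiv_fun_smul hg (mdifferentiableAt_toCoord hy hτ),
        D.isCovariantDerivativeOn.leibniz (s := univ) hτ hg]
      simp [ofCoord_toCoord hy, smul_sub]
    · intro τ τ' hτ hτ'
      have h1 : (fun y' => toCoord F x₀ y' ((τ + τ') y')) =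
          fun y' => toCoord F x₀ y' (τ y') + toCoord F x₀ y' (τ' y') := by
        funext y'; simp
      simp only [hΦ]
      rw [h1, mvfderiv_fun_add (mdifferentiableAt_toCoord hy hτ) (mdifferentiableAt_toCoord hy hτ'),
        D.isCovariantDerivativeOn.add (s := univ) hτ hτ']
      simp
      abel
  have h2 := hten.pointwise hσ
    (mdifferentiableAt_ofCoord (n := fun _ => toCoord F x₀ y (σ y)) hy mdifferentiableAt_const)
    (ofCoord_toCoord hy (σ y)).symm
  have h3 : mvfderiv I (fun y' => toCoord F x₀ y' (ofCoord x₀ y' (toCoord F x₀ y (σ y)) : V y')) y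
      = 0 := by
    have : (fun y' => toCoord F x₀ y' (ofCoord x₀ y' (toCoord F x₀ y (σ y)) : V y')) =ᶠ[𝓝 y]
        fun _ => toCoord F x₀ y (σ y) := by
      filter_upwards [eventually_mem_baseSet hy] with y' hy'
      rw [toCoord_ofCoord hy']
    unfold mvfderiv
    rw [this.mfderiv_eq, mfderiv_const]
    exact ContinuousLinearMap.comp_zero _
  simp only [hΦ] at h2
  rw [h3] at h2
  simp only [zero_apply, map_zero, sub_zero] at h2
  rw [← h2]
  abel

end Smooth

end Connection

section AlongCurve

variable {E : Type*} [NormedAddCommGroup E] [NormedSpace ℝ E]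
  {H : Type*} [TopologicalSpace H] {I : ModelWithCorners ℝ E H}
  {M : Type*} [TopologicalSpace M] [ChartedSpace H M]
  {F : Type*} [NormedAddCommGroup F] [NormedSpace ℝ F] [FiniteDimensional ℝ F]
  {V : M → Type*} [TopologicalSpace (TotalSpace F V)]
  [∀ x, NormedAddCommGroup (V x)] [∀ x, InnerProductSpace ℝ (V x)]
  [FiberBundle F V] [VectorBundle ℝ F V] [ContMDiffVectorBundle 1 F V I]
  {D : CovariantDerivative I F V} {x₀ : M} {γ : ℝ → M} {J : Set ℝ} {s : ℝ}

/-- The covariant derivative along a curve can be computed in any trivialization. -/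
theorem covDerivAlong_ofCoord {n : ℝ → F} {n' : F}
    (hγ : MDifferentiableWithinAt 𝓘(ℝ, ℝ) I γ J s) (hs : s ∈ J) (hJ : UniqueDiffWithinAt ℝ J s)
    (hx : γ s ∈ (trivializationAt F V x₀).baseSet) (hn : HasDerivWithinAt n n' J s) :
    DifferentiableWithinAt ℝ
      (fiberCoord (F := F) (V := V) (γ s) γ (fun r => ofCoord x₀ (γ r) (n r))) J s ∧
    covDerivAlong D γ (fun r => ofCoord x₀ (γ r) (n r)) J s = ofCoord x₀ (γ s) n' +
      D (fun y => ofCoord x₀ y (n s)) (γ s) (mfderivWithin 𝓘(ℝ, ℝ) I γ J s (1 : ℝ)) := by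
  set e := trivializationAt F V x₀ with he
  set e' := trivializationAt F V (γ s) with he'
  have hx' : γ s ∈ e'.baseSet := mem_baseSet_trivializationAt F V (γ s)
  set γ' := mfderivWithin 𝓘(ℝ, ℝ) I γ J s (1 : ℝ) with hγ'
  have hev : ∀ᶠ r in 𝓝[J] s, γ r ∈ e.baseSet ∧ γ r ∈ e'.baseSet :=
    hγ.continuousWithinAt.tendsto.eventually
      ((eventually_mem_baseSet hx).and (eventually_mem_baseSet hx'))
  have hcc : ∀ y ∈ e.baseSet ∩ e'.baseSet, ∀ w : F,
      toCoord F (γ s) y (ofCoord x₀ y w : V y) = (e.coordChangeL ℝ e' y : F →L[ℝ] F) w := by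
    intro y hy w
    rw [toCoord_apply hy.2, ofCoord_apply hy.1]
    exact (e.coordChangeL_apply e' hy w).symm
  -- the derivative of the section with constant coordinates
  set σ : ∀ y, V y := fun y => ofCoord x₀ y (n s) with hσ
  have hσd : MDifferentiableAt I (I.prod 𝓘(ℝ, F)) (fun y' => TotalSpace.mk' F y' (σ y')) (γ s) :=
    mdifferentiableAt_ofCoord (n := fun _ => n s) hx mdifferentiableAt_const
  have h1 : HasDerivWithinAt (fun r => toCoord F (γ s) (γ r) (σ (γ r)))
      (mvfderiv I (fun y => toCoord F (γ s) y (σ y)) (γ s) γ') J s :=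
    hasDerivWithinAt_comp_curve (mdifferentiableAt_toCoord hx' hσd) hγ
  -- the coordinate change
  have hc : MDifferentiableAt I 𝓘(ℝ, F →L[ℝ] F)
      (fun y : M => (e.coordChangeL ℝ e' y : F →L[ℝ] F)) (γ s) :=
    (contMDiffAt_coordChangeL (n := 1) (IB := I) hx hx').mdifferentiableAt one_ne_zero
  have h2 := hasDerivWithinAt_comp_curve hc hγ
  -- Since `n r - n s` vanishes at `s`, the derivative of the coordinate change does not contribute
  -- here; it enters through `h1`.
  have h3 : HasDerivWithinAt (fun r => (e.coordChangeL ℝ e' (γ r) : F →L[ℝ] F) (n r - n s))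
      ((e.coordChangeL ℝ e' (γ s) : F →L[ℝ] F) n') J s := by
    have := h2.clm_apply (hn.sub_const (n s))
    simpa using this
  have h4 : HasDerivWithinAt
      (fiberCoord (F := F) (V := V) (γ s) γ (fun r => ofCoord x₀ (γ r) (n r)))
      (mvfderiv I (fun y => toCoord F (γ s) y (σ y)) (γ s) γ' +
        (e.coordChangeL ℝ e' (γ s) : F →L[ℝ] F) n') J s := by
    refine (h1.add h3).congr_of_eventuallyEq_of_mem ?_ hs
    filter_upwards [hev] with r hr
    simp only [fiberCoord, Pi.add_apply]
    rw [← toCoord_apply hr.2, hcc _ hr, hσ, hcc _ hr, ← map_add, add_sub_cancel]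
  refine ⟨h4.differentiableWithinAt, ?_⟩
  have h5 : fiberCoord (F := F) (V := V) (γ s) γ (fun r => ofCoord x₀ (γ r) (n r)) s =
      toCoord F (γ s) (γ s) (σ (γ s)) := by
    simp only [fiberCoord]
    rw [← toCoord_apply hx']
  have h6 : D (constSection (V := V) (γ s) (toCoord F (γ s) (γ s) (σ (γ s)))) (γ s) =
      D (fun y' => ofCoord (γ s) y' (toCoord F (γ s) (γ s) (σ (γ s)))) (γ s) := by
    have hd := mdifferentiableAt_ofCoord (I := I) (V := V) (x₀ := γ s)
      (n := fun _ => toCoord F (γ s) (γ s) (σ (γ s))) hx' mdifferentiableAt_const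
    have heq : ∀ᶠ y in 𝓝 (γ s), constSection (V := V) (γ s) (toCoord F (γ s) (γ s) (σ (γ s))) y =
        ofCoord (γ s) y (toCoord F (γ s) (γ s) (σ (γ s))) := by
      filter_upwards [eventually_mem_baseSet hx'] with y hy
      rw [ofCoord_apply hy]; rfl
    refine D.isCovariantDerivativeOn.congr_of_eventuallyEq (s := univ) (F := F) ?_ hd univ_mem heq
    refine hd.congr_of_eventuallyEq ?_
    filter_upwards [heq] with y hy
    rw [hy]
  rw [covDerivAlong, h4.derivWithin hJ, h5, h6, covDeriv_eq D hx' hσd γ', constSection,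
    ← ofCoord_apply hx', map_add]
  have h7 : ofCoord (γ s) (γ s) ((e.coordChangeL ℝ e' (γ s) : F →L[ℝ] F) n') =
      (ofCoord x₀ (γ s) n' : V (γ s)) := by
    rw [← hcc _ ⟨hx, hx'⟩, ofCoord_toCoord hx']
  rw [h7]
  abel

omit [FiniteDimensional ℝ F] [ContMDiffVectorBundle 1 F V I] in
theorem isContinuousRiemannianBundle (h : IsContMDiffRiemannianBundle I 1 F V) :
    IsContinuousRiemannianBundle F V := by
  obtain ⟨g, hg, h⟩ := h.exists_contMDiff
  exact ⟨g, hg.continuous, h⟩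

variable [hR : IsContMDiffRiemannianBundle I 1 F V]

/-- Split `⟪a, b⟫` into `⟪a s, b s⟫ + ⟪a - a s, b⟫ + ⟪a s, b - b s⟫`, identifying vectors in `F`
with local sections. Metric compatibility differentiates the first term; the others have a factor
vanishing at `s`, so continuity of the metric suffices for them. -/
theorem hasDerivWithinAt_inner_ofCoord (hD : D.IsMetricCompatible) {a b : ℝ → F} {a' b' : F}
    (hγ : MDifferentiableWithinAt 𝓘(ℝ, ℝ) I γ J s)
    (hx : γ s ∈ (trivializationAt F V x₀).baseSet) (ha : HasDerivWithinAt a a' J s)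
    (hb : HasDerivWithinAt b b' J s) :
    HasDerivWithinAt
      (fun r => inner ℝ (ofCoord x₀ (γ r) (a r) : V (γ r)) (ofCoord x₀ (γ r) (b r)))
      (inner ℝ (ofCoord x₀ (γ s) a' +
          D (fun y => ofCoord x₀ y (a s)) (γ s) (mfderivWithin 𝓘(ℝ, ℝ) I γ J s (1 : ℝ)))
          (ofCoord x₀ (γ s) (b s)) +
        inner ℝ (ofCoord x₀ (γ s) (a s) : V (γ s)) (ofCoord x₀ (γ s) b' +
          D (fun y => ofCoord x₀ y (b s)) (γ s) (mfderivWithin 𝓘(ℝ, ℝ) I γ J s (1 : ℝ)))) J s := by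
  classical
  have := isContinuousRiemannianBundle hR
  set γ' := mfderivWithin 𝓘(ℝ, ℝ) I γ J s (1 : ℝ) with hγ'
  have hsec : ∀ w : F, MDifferentiableAt I (I.prod 𝓘(ℝ, F))
      (fun y' => TotalSpace.mk' F y' (ofCoord x₀ y' w : V y')) (γ s) := fun w =>
    mdifferentiableAt_ofCoord (n := fun _ => w) hx mdifferentiableAt_const
  have hin : MDifferentiableAt I 𝓘(ℝ, ℝ)
      (fun y => inner ℝ (ofCoord x₀ y (a s) : V y) (ofCoord x₀ y (b s))) (γ s) :=
    (hsec (a s)).inner_bundle (hsec (b s))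
  have h1 := hasDerivWithinAt_comp_curve hin hγ
  have h1' := hD.mvfderiv_inner_eq (x := γ s)
    (Function.update 0 (γ s) γ') (hsec (a s)) (hsec (b s))
  simp only [Function.update_self] at h1'
  rw [h1'] at h1
  have hcont : ∀ {n : ℝ → F}, ContinuousWithinAt n J s → ContinuousWithinAt
      (fun r => TotalSpace.mk' F (γ r) (ofCoord x₀ (γ r) (n r) : V (γ r))) J s := fun hn =>
    continuousWithinAt_ofCoord hγ.continuousWithinAt hn hx
  -- bilinear terms in which one factor vanishes at `s`
  have hvan : ∀ {u w : ℝ → F} {u' : F}, HasDerivWithinAt u u' J s → u s = 0 →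
      ContinuousWithinAt w J s → HasDerivWithinAt
        (fun r => inner ℝ (ofCoord x₀ (γ r) (u r) : V (γ r)) (ofCoord x₀ (γ r) (w r)))
        (inner ℝ (ofCoord x₀ (γ s) u' : V (γ s)) (ofCoord x₀ (γ s) (w s))) J s := by
    intro u w u' hu hu0 hw
    -- Expanding the vanishing factor in a basis makes each summand a scalar that vanishes at `s`
    -- times a continuous function.
    set β := Module.finBasis ℝ F
    have hexp : ∀ (y : M) (v : F) (z : V y), inner ℝ (ofCoord x₀ y v : V y) z =
        ∑ i, β.coord i v * inner ℝ (ofCoord x₀ y (β i) : V y) z := by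
      intro y v z
      conv_lhs => rw [← β.sum_repr v]
      simp only [map_sum, map_smul, sum_inner, real_inner_smul_left, Module.Basis.coord_apply]
    rw [funext fun r => hexp (γ r) (u r) (ofCoord x₀ (γ r) (w r)),
      hexp (γ s) u' (ofCoord x₀ (γ s) (w s))]
    refine HasDerivWithinAt.fun_sum fun i _ => ?_
    have hui : HasDerivWithinAt (fun r => β.coord i (u r)) (β.coord i u') J s :=
      (LinearMap.toContinuousLinearMap (β.coord i)).hasFDerivAt.comp_hasDerivWithinAt s hu
    refine hasDerivWithinAt_mul_of_eq_zero hui (by simp [hu0]) ?_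
    exact (hcont (n := fun _ => β i) continuousWithinAt_const).inner_bundle (hcont hw)
  have h2 := hvan (ha.sub_const (a s)) (sub_self _) hb.continuousWithinAt
  have h3 := hvan (w := fun _ => a s) (hb.sub_const (b s)) (sub_self _) continuousWithinAt_const
  refine ((h1.add h2).add h3).congr_deriv ?_ |>.congr_of_eventuallyEq ?_ ?_
  · rw [inner_add_left, inner_add_right, real_inner_comm (ofCoord x₀ (γ s) (a s)) ]
    ring
  · refine Eventually.of_forall fun r => ?_
    simp only [Pi.add_apply, map_sub, inner_sub_left]
    rw [real_inner_comm (ofCoord x₀ (γ r) (a s)), real_inner_comm (ofCoord x₀ (γ r) (a s))]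
    ring
  · simp

/-- The derivative along a curve of the inner product of a section with a vector field along the
curve. -/
theorem hasDerivWithinAt_inner_section (hD : D.IsMetricCompatible) {σ : ∀ y, V y} {b : ℝ → F}
    {b' : F} (hγ : MDifferentiableWithinAt 𝓘(ℝ, ℝ) I γ J s) (hs : s ∈ J)
    (hx : γ s ∈ (trivializationAt F V x₀).baseSet)
    (hσ : MDifferentiableAt I (I.prod 𝓘(ℝ, F)) (fun y' => TotalSpace.mk' F y' (σ y')) (γ s))
    (hb : HasDerivWithinAt b b' J s) :
    HasDerivWithinAt (fun r => inner ℝ (σ (γ r)) (ofCoord x₀ (γ r) (b r)))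
      (inner ℝ (D σ (γ s) (mfderivWithin 𝓘(ℝ, ℝ) I γ J s (1 : ℝ))) (ofCoord x₀ (γ s) (b s)) +
        inner ℝ (σ (γ s)) (ofCoord x₀ (γ s) b' +
          D (fun y => ofCoord x₀ y (b s)) (γ s) (mfderivWithin 𝓘(ℝ, ℝ) I γ J s (1 : ℝ)))) J s := by
  have h1 := hasDerivWithinAt_comp_curve (mdifferentiableAt_toCoord hx hσ) hγ
  have h2 := hasDerivWithinAt_inner_ofCoord hD hγ hx h1 hb
  rw [← covDeriv_eq D hx hσ, ofCoord_toCoord hx] at h2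
  refine h2.congr_of_eventuallyEq_of_mem ?_ hs
  filter_upwards [hγ.continuousWithinAt.tendsto.eventually (eventually_mem_baseSet hx)] with r hr
  rw [ofCoord_toCoord hr]

end AlongCurve

/-- In finite dimension a bilinear map is controlled by finitely many values on basis vectors, and
these stay near their values at `x₀`. So continuity for fixed arguments already gives a locally
uniform bound. -/
theorem exists_eventually_bilinear_bound {E F G X : Type*} [NormedAddCommGroup E] [NormedSpace ℝ E]
    [FiniteDimensional ℝ E] [NormedAddCommGroup F] [NormedSpace ℝ F] [FiniteDimensional ℝ F]
    [NormedAddCommGroup G] [NormedSpace ℝ G] [TopologicalSpace X] {B : X → E → F → G} {x₀ : X}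
    (hlin : ∀ᶠ x in 𝓝 x₀, (∀ ζ, IsLinearMap ℝ (B x ζ)) ∧ ∀ w, IsLinearMap ℝ fun ζ => B x ζ w)
    (hcont : ∀ ζ w, ContinuousAt (fun x => B x ζ w) x₀) :
    ∃ K > 0, ∀ᶠ x in 𝓝 x₀, ∀ ζ w, ‖B x ζ w‖ ≤ K * ‖ζ‖ * ‖w‖ := by
  set β := Module.finBasis ℝ E
  set κ := Module.finBasis ℝ F
  set β' : Fin _ → E →L[ℝ] ℝ := fun i => LinearMap.toContinuousLinearMap (β.coord i) with hβ'
  set κ' : Fin _ → F →L[ℝ] ℝ := fun i => LinearMap.toContinuousLinearMap (κ.coord i) with hκ'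
  set K : ℝ := ∑ i, ∑ j, ‖β' i‖ * ‖κ' j‖ * (‖B x₀ (β i) (κ j)‖ + 1) with hK
  have hK0 : 0 ≤ K := by positivity
  have hev : ∀ᶠ x in 𝓝 x₀, ∀ i j, ‖B x (β i) (κ j)‖ < ‖B x₀ (β i) (κ j)‖ + 1 := by
    simp only [eventually_all]
    exact fun i j => (hcont (β i) (κ j)).norm.eventually (gt_mem_nhds (by linarith))
  refine ⟨K + 1, by positivity, ?_⟩
  filter_upwards [hlin, hev] with x hx hb ζ w
  have hexp : B x ζ w = ∑ i, ∑ j, (β' i ζ * κ' j w) • B x (β i) (κ j) := by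
    have h1 : B x ζ w = ∑ i, β' i ζ • B x (β i) w := by
      conv_lhs => rw [← β.sum_repr ζ]
      have := map_sum (hx.2 w).mk' (fun i => β.repr ζ i • β i) Finset.univ
      simp only [IsLinearMap.mk'_apply, map_smul] at this
      rw [this]
      rfl
    rw [h1]
    refine Finset.sum_congr rfl fun i _ => ?_
    have h2 : B x (β i) w = ∑ j, κ' j w • B x (β i) (κ j) := by
      conv_lhs => rw [← κ.sum_repr w]
      have := map_sum (hx.1 (β i)).mk' (fun j => κ.repr w j • κ j) Finset.univ
      simp only [IsLinearMap.mk'_apply] at this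
      rw [this]
      refine Finset.sum_congr rfl fun j _ => ?_
      rw [(hx.1 (β i)).map_smul]
      rfl
    rw [h2, Finset.smul_sum]
    simp only [smul_smul]
  rw [hexp]
  calc ‖∑ i, ∑ j, (β' i ζ * κ' j w) • B x (β i) (κ j)‖
      ≤ ∑ i, ∑ j, ‖β' i‖ * ‖κ' j‖ * (‖B x₀ (β i) (κ j)‖ + 1) * (‖ζ‖ * ‖w‖) := by
        refine norm_sum_le_of_le _ fun i _ => norm_sum_le_of_le _ fun j _ => ?_
        rw [norm_smul, norm_mul]
        have h1 := (β' i).le_opNorm ζ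
        have h2 := (κ' j).le_opNorm w
        calc ‖β' i ζ‖ * ‖κ' j w‖ * ‖B x (β i) (κ j)‖
            ≤ (‖β' i‖ * ‖ζ‖) * (‖κ' j‖ * ‖w‖) * (‖B x₀ (β i) (κ j)‖ + 1) := by
              gcongr
              exact (hb i j).le
          _ = _ := by ring
    _ = K * (‖ζ‖ * ‖w‖) := by simp only [hK, Finset.sum_mul]
    _ ≤ (K + 1) * ‖ζ‖ * ‖w‖ := by
        nlinarith [mul_nonneg (norm_nonneg ζ) (norm_nonneg w)]

/-! ### Lines in charts and connection coefficients -/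

section Chart

variable {E : Type*} [NormedAddCommGroup E] [NormedSpace ℝ E]
  {H : Type*} [TopologicalSpace H] {I : ModelWithCorners ℝ E H}
  {M : Type*} [TopologicalSpace M] [ChartedSpace H M]

variable (I) in
/-- The curve which is the straight line `z + r ζ` in the chart at `x₀`. -/
def chartLine (x₀ : M) (z ζ : E) (r : ℝ) : M := (extChartAt I x₀).symm (z + r • ζ)

variable [IsManifold I ∞ M]

/-- The vector at `y` with coordinate `ζ` in the chart at `x₀`. -/
def coordVec (x₀ : M) (ζ : E) (y : M) : TangentSpace I y :=
  (trivializationAt E (TangentSpace I : M → Type _) x₀).symmL ℝ y ζ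

theorem contMDiffOn_chartLine {x₀ : M} {z ζ : E} {J : Set ℝ}
    (h : ∀ r ∈ J, z + r • ζ ∈ (extChartAt I x₀).target) :
    ContMDiffOn 𝓘(ℝ, ℝ) I ∞ (chartLine I x₀ z ζ) J := by
  refine (contMDiffOn_extChartAt_symm (n := ∞) x₀).comp (t := (extChartAt I x₀).target) ?_ h
  have : ContDiff ℝ ∞ (fun r : ℝ => z + r • ζ) := by fun_prop
  exact this.contMDiff.contMDiffOn

/-- The velocity of the line is the restriction of a smooth field with constant coordinates, so
differentiating twice along the line is differentiating twice in the direction of that field. -/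
theorem mfderivWithin_chartLine {x₀ : M} {z ζ : E} {J : Set ℝ}
    (h : ∀ r ∈ J, z + r • ζ ∈ (extChartAt I x₀).target) {r : ℝ} (hr : r ∈ J)
    (hJ : UniqueDiffWithinAt ℝ J r) :
    mfderivWithin 𝓘(ℝ, ℝ) I (chartLine I x₀ z ζ) J r (1 : ℝ) =
      coordVec x₀ ζ (chartLine I x₀ z ζ r) := by
  have h1 : MDifferentiableWithinAt 𝓘(ℝ, E) I (extChartAt I x₀).symm (range I) (z + r • ζ) :=
    mdifferentiableWithinAt_extChartAt_symm (h r hr)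
  have h2 : HasFDerivWithinAt (fun r : ℝ => z + r • ζ)
      (ContinuousLinearMap.toSpanSingleton ℝ ζ) J r := by
    have : HasDerivWithinAt (fun r : ℝ => z + r • ζ) ζ J r := by
      simpa using ((hasDerivWithinAt_id r J).smul_const ζ).const_add z
    exact this.hasFDerivWithinAt
  have h3 := h1.hasMFDerivWithinAt.comp (f := fun r : ℝ => z + r • ζ) r h2.hasMFDerivWithinAt
    (fun s hs => extChartAt_target_subset_range x₀ (h s hs))
  have h4 := h3.mfderivWithin (hJ.uniqueMDiffWithinAt)
  have h5 : chartLine I x₀ z ζ = (extChartAt I x₀).symm ∘ (fun r : ℝ => z + r • ζ) := rfl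
  rw [← h5] at h4
  rw [h4]
  have hsrc : chartLine I x₀ z ζ r ∈ (chartAt H x₀).source := by
    rw [← extChartAt_source I]
    exact (extChartAt I x₀).map_target (h r hr)
  rw [coordVec, TangentBundle.symmL_trivializationAt hsrc]
  have h6 : extChartAt I x₀ (chartLine I x₀ z ζ r) = z + r • ζ :=
    (extChartAt I x₀).right_inv (h r hr)
  rw [h6]
  change mfderivWithin 𝓘(ℝ, E) I (extChartAt I x₀).symm (range I) (z + r • ζ)
    ((1 : ℝ) • ζ) = _
  rw [one_smul]
  rfl

theorem contMDiffAt_coordVec {x₀ y : M} (ζ : E) (hy : y ∈ (chartAt H x₀).source) :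
    ContMDiffAt I I.tangent ∞ (fun y' => (⟨y', coordVec x₀ ζ y'⟩ : TangentBundle I M)) y := by
  have hy' : y ∈ (trivializationAt E (TangentSpace I : M → Type _) x₀).baseSet := by
    rwa [TangentBundle.trivializationAt_baseSet]
  refine ((trivializationAt E (TangentSpace I : M → Type _) x₀).contMDiffAt_section_iff hy').2 ?_
  refine (contMDiffAt_const (c := ζ)).congr_of_eventuallyEq ?_
  filter_upwards [(trivializationAt E (TangentSpace I : M → Type _) x₀).open_baseSet.mem_nhds hy']
    with y' h
  rw [coordVec, Trivialization.symmL_apply _ h, Trivialization.apply_mk_symm _ h]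

theorem exists_coordVec_eq {x₀ y : M} (hy : y ∈ (chartAt H x₀).source) (X : TangentSpace I y) :
    ∃ ζ : E, X = coordVec x₀ ζ y := by
  have hy' : y ∈ (trivializationAt E (TangentSpace I : M → Type _) x₀).baseSet := by
    rwa [TangentBundle.trivializationAt_baseSet]
  exact ⟨_, (Trivialization.symmL_continuousLinearMapAt (R := ℝ) _ hy' X).symm⟩

end Chart

section Christoffel

variable {E : Type*} [NormedAddCommGroup E] [NormedSpace ℝ E]
  {H : Type*} [TopologicalSpace H] {I : ModelWithCorners ℝ E H}
  {M : Type*} [TopologicalSpace M] [ChartedSpace H M] [IsManifold I ∞ M]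
  {F : Type*} [NormedAddCommGroup F] [NormedSpace ℝ F]
  {V : M → Type*} [TopologicalSpace (TotalSpace F V)]
  [∀ x, NormedAddCommGroup (V x)] [∀ x, InnerProductSpace ℝ (V x)]
  [FiberBundle F V] [VectorBundle ℝ F V]

/-- The connection coefficients of `D` in the chart and the trivialization at `x₀`. -/
def christoffel (D : CovariantDerivative I F V) (x₀ y : M) (ζ : E) (w : F) : F :=
  toCoord F x₀ y (D (fun y' => ofCoord x₀ y' w) y (coordVec x₀ ζ y))

theorem ofCoord_christoffel (D : CovariantDerivative I F V) {x₀ y : M}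
    (hy : y ∈ (trivializationAt F V x₀).baseSet) (ζ : E) (w : F) :
    (ofCoord x₀ y (christoffel D x₀ y ζ w) : V y) =
      D (fun y' => ofCoord x₀ y' w) y (coordVec x₀ ζ y) :=
  ofCoord_toCoord hy _

theorem isLinearMap_christoffel_left (D : CovariantDerivative I F V) (x₀ y : M) (w : F) :
    IsLinearMap ℝ fun ζ => christoffel D x₀ y ζ w := by
  constructor <;> intros <;> simp [christoffel, coordVec]

theorem isLinearMap_christoffel_right [ContMDiffVectorBundle 1 F V I]
    (D : CovariantDerivative I F V) {x₀ y : M}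
    (hy : y ∈ (trivializationAt F V x₀).baseSet) (ζ : E) :
    IsLinearMap ℝ (christoffel D x₀ y ζ) := by
  have hd : ∀ w : F, MDifferentiableAt I (I.prod 𝓘(ℝ, F))
      (fun y' => TotalSpace.mk' F y' (ofCoord x₀ y' w : V y')) y := fun w =>
    mdifferentiableAt_ofCoord (n := fun _ => w) hy mdifferentiableAt_const
  constructor
  · intro w w'
    have h := D.isCovariantDerivativeOn.add (hd w) (hd w') (mem_univ y)
    have h1 : (fun y' => ofCoord x₀ y' (w + w') : ∀ y', V y') =
        (fun y' => ofCoord x₀ y' w : ∀ y', V y') + fun y' => ofCoord x₀ y' w' := by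
      funext y'; simp
    simp only [christoffel, h1]
    erw [h]
    simp
  · intro c w
    have h := D.isCovariantDerivativeOn.smul_const c (hd w) (mem_univ y)
    have h1 : (fun y' => ofCoord x₀ y' (c • w) : ∀ y', V y') =
        c • (fun y' => ofCoord x₀ y' w : ∀ y', V y') := by
      funext y'; simp
    simp only [christoffel, h1]
    erw [h]
    simp

/-- A covariant derivative of a smooth section in a smooth direction is a smooth section. -/
theorem contMDiffAt_covDeriv {D : CovariantDerivative I F V}
    (hD : ContMDiffCovariantDerivativeOn F ∞ D.toFun univ) {σ : ∀ y, V y}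
    (hσ : ContMDiff I (I.prod 𝓘(ℝ, F)) ∞ (fun y => TotalSpace.mk' F y (σ y)))
    {X : ∀ y : M, TangentSpace I y} {y : M}
    (hX : ContMDiffAt I I.tangent ∞ (fun y' => (⟨y', X y'⟩ : TangentBundle I M)) y) :
    ContMDiffAt I (I.prod 𝓘(ℝ, F)) ∞ (fun y' => TotalSpace.mk' F y' (D σ y' (X y'))) y := by
  have h1 := (hD.contMDiff (σ := σ) (by simpa using hσ.contMDiffOn)).contMDiffAt
    (x := y) (by simp)
  exact ContMDiffAt.clm_bundle_apply h1 hX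

variable [FiniteDimensional ℝ E] [T2Space M] [ContMDiffVectorBundle ∞ F V I]

/-- Sections with constant coordinates near a point extend to global smooth sections. -/
theorem exists_contMDiff_eq_ofCoord (I : ModelWithCorners ℝ E H) [IsManifold I ∞ M]
    [ContMDiffVectorBundle ∞ F V I] (x₀ : M) :
    ∃ U : Set M, IsOpen U ∧ x₀ ∈ U ∧ U ⊆ (trivializationAt F V x₀).baseSet ∧
      ∀ w : F, ∃ σ : ∀ y, V y,
        ContMDiff I (I.prod 𝓘(ℝ, F)) ∞ (fun y => TotalSpace.mk' F y (σ y)) ∧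
        ∀ y ∈ U, σ y = ofCoord x₀ y w := by
  have hb : (trivializationAt F V x₀).baseSet ∈ 𝓝 x₀ :=
    eventually_mem_baseSet (mem_baseSet_trivializationAt F V x₀)
  obtain ⟨ψ, -, hψ⟩ := (SmoothBumpFunction.nhds_basis_tsupport (I := I) x₀).mem_iff.1 hb
  obtain ⟨U, hU, hUo, hxU⟩ := eventually_nhds_iff.1 (ψ.eventuallyEq_one.and hb)
  refine ⟨U, hUo, hxU, fun y hy => (hU y hy).2, fun w => ⟨fun y => ψ y • ofCoord x₀ y w, ?_, ?_⟩⟩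
  · refine ContMDiffOn.smul_section_of_tsupport (ψ := ψ) ψ.contMDiff.contMDiffOn
      (trivializationAt F V x₀).open_baseSet hψ ?_
    intro y hy
    refine ContMDiffAt.contMDiffWithinAt ?_
    refine ((trivializationAt F V x₀).contMDiffAt_section_iff hy).2 ?_
    refine (contMDiffAt_const (c := w)).congr_of_eventuallyEq ?_
    filter_upwards [eventually_mem_baseSet hy] with y' h
    rw [← toCoord_apply h, toCoord_ofCoord h]
  · intro y hy
    have := (hU y hy).1
    simp [this]

/-- Smoothness of `D` is applied to globally smooth sections. Sections with constant coordinates are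
therefore replaced by global extensions, which does not change `D` nearby because connections are
local. -/
theorem eventually_continuousAt_christoffel [FiniteDimensional ℝ F] {D : CovariantDerivative I F V}
    (hD : ContMDiffCovariantDerivativeOn F ∞ D.toFun univ) (x₀ : M) :
    ∀ᶠ y in 𝓝 x₀, ∀ ζ w, ContinuousAt (fun y' => christoffel D x₀ y' ζ w) y := by
  obtain ⟨U, hUo, hxU, hUb, hσ⟩ := exists_contMDiff_eq_ofCoord (F := F) (V := V) I x₀
  filter_upwards [hUo.mem_nhds hxU, (chartAt H x₀).open_source.mem_nhds (mem_chart_source H x₀)]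
    with y hy hyc ζ w
  obtain ⟨σ, hσ, hσe⟩ := hσ w
  have h1 := contMDiffAt_covDeriv hD hσ (contMDiffAt_coordVec (I := I) ζ hyc)
  have h2 := (mdifferentiableAt_toCoord (hUb hy) (h1.mdifferentiableAt (by simp))).continuousAt
  refine h2.congr ?_
  filter_upwards [hUo.mem_nhds hy] with y' hy'
  rw [christoffel]
  congr 2
  refine D.isCovariantDerivativeOn.congr_of_eventuallyEq (s := univ) (F := F)
    (hσ.mdifferentiableAt (by simp)) (mdifferentiableAt_ofCoord (n := fun _ => w) (hUb hy')
      mdifferentiableAt_const) univ_mem ?_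
  filter_upwards [hUo.mem_nhds hy'] with y'' hy'' using hσe _ hy''

variable (I) in
/-- The part inside the model space of a ball around the base point in a chart. -/
def chartBall (x₀ : M) (δ : ℝ) : Set E := Metric.ball (extChartAt I x₀ x₀) δ ∩ range I

/-- The chart domain of radius `δ` around `x₀` is so small that the connection coefficients
are bounded by `K`, and that parallel transport along lines in it is easily controlled. -/
structure IsAdapted (D : CovariantDerivative I F V) (x₀ : M) (δ K : ℝ) : Prop where
  pos : 0 < δ
  K_pos : 0 < K
  small : 4 * (δ * K) ≤ 1
  mem_target : ∀ z ∈ chartBall I x₀ δ, z ∈ (extChartAt I x₀).target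
  mem_baseSet : ∀ z ∈ chartBall I x₀ δ,
    (extChartAt I x₀).symm z ∈ (trivializationAt F V x₀).baseSet
  norm_le : ∀ z ∈ chartBall I x₀ δ, ∀ ζ w,
    ‖christoffel D x₀ ((extChartAt I x₀).symm z) ζ w‖ ≤ K * ‖ζ‖ * ‖w‖
  continuousOn : ∀ ζ w, ContinuousOn
    (fun z => christoffel D x₀ ((extChartAt I x₀).symm z) ζ w) (chartBall I x₀ δ)

theorem exists_isAdapted [FiniteDimensional ℝ F] {D : CovariantDerivative I F V}
    (hD : ContMDiffCovariantDerivativeOn F ∞ D.toFun univ) (x₀ : M) :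
    ∃ δ K, IsAdapted D x₀ δ K := by
  have hb := eventually_mem_baseSet (mem_baseSet_trivializationAt F V x₀)
  have hc := eventually_continuousAt_christoffel hD x₀
  obtain ⟨K, hK, hKb⟩ := exists_eventually_bilinear_bound (B := christoffel D x₀) (x₀ := x₀)
    (hb.mono fun y hy => ⟨isLinearMap_christoffel_right D hy,
      isLinearMap_christoffel_left D x₀ y⟩) hc.self_of_nhds
  have h1 : ∀ᶠ z in 𝓝[range I] (extChartAt I x₀ x₀), z ∈ (extChartAt I x₀).target :=
    extChartAt_target_mem_nhdsWithin x₀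
  have h2 : Tendsto (extChartAt I x₀).symm (𝓝[range I] (extChartAt I x₀ x₀)) (𝓝 x₀) := by
    have := (continuousAt_extChartAt_symm (I := I) x₀).tendsto
    rw [extChartAt_to_inv] at this
    exact this.mono_left nhdsWithin_le_nhds
  obtain ⟨δ, hδ, hδs⟩ := Metric.mem_nhdsWithin_iff.1
    (h1.and (h2.eventually (hb.and (hc.and hKb))))
  -- The second bound is exactly the condition `4 * (δ * K) ≤ 1`.
  refine ⟨min δ (1 / (4 * K)), K, lt_min hδ (by positivity), hK, ?_, ?_, ?_, ?_, ?_⟩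
  · have : min δ (1 / (4 * K)) * K ≤ 1 / (4 * K) * K := by gcongr; exact min_le_right _ _
    have h3 : 1 / (4 * K) * K = 1 / 4 := by field_simp
    linarith
  all_goals
    have hsub : chartBall I x₀ (min δ (1 / (4 * K))) ⊆ Metric.ball (extChartAt I x₀ x₀) δ ∩ range I :=
      inter_subset_inter_left _ (Metric.ball_subset_ball (min_le_left _ _))
  · exact fun z hz => (hδs (hsub hz)).1
  · exact fun z hz => (hδs (hsub hz)).2.1
  · exact fun z hz => (hδs (hsub hz)).2.2.2
  · intro ζ w z hz
    have h4 := hδs (hsub hz)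
    exact (ContinuousAt.comp (f := (extChartAt I x₀).symm) (h4.2.2.1 ζ w)
      (continuousAt_extChartAt_symm'' (h4.1))).continuousWithinAt

end Christoffel

/-! ### Parallel transport along lines in a chart -/

section Transport

variable {E : Type*} [NormedAddCommGroup E] [NormedSpace ℝ E]
  {H : Type*} [TopologicalSpace H] {I : ModelWithCorners ℝ E H}
  {M : Type*} [TopologicalSpace M] [ChartedSpace H M] [IsManifold I ∞ M]
  {F : Type*} [NormedAddCommGroup F] [NormedSpace ℝ F]
  {V : M → Type*} [TopologicalSpace (TotalSpace F V)]
  [∀ x, NormedAddCommGroup (V x)] [∀ x, InnerProductSpace ℝ (V x)]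
  [FiberBundle F V] [VectorBundle ℝ F V]
  {D : CovariantDerivative I F V} {x₀ : M} {δ K : ℝ} {z ζ : E} {a b : ℝ → F}

omit [IsManifold I ∞ M] in
theorem add_smul_mem_chartBall (hz : z ∈ chartBall I x₀ δ) (hζ : z + ζ ∈ chartBall I x₀ δ) {r : ℝ}
    (hr : r ∈ Icc (0 : ℝ) 1) : z + r • ζ ∈ chartBall I x₀ δ :=
  ((convex_ball _ _).inter I.convex_range).add_smul_mem hz hζ hr

/-- `a` gives the coordinates of a parallel field along the line `z + r ζ` in the chart. -/
def IsTransport (D : CovariantDerivative I F V) (x₀ : M) (z ζ : E) (a : ℝ → F) : Prop :=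
  ∀ r ∈ Icc (0 : ℝ) 1,
    HasDerivWithinAt a (-christoffel D x₀ (chartLine I x₀ z ζ r) ζ (a r)) (Icc 0 1) r

/-- The restriction of a parallel field to a subsegment, possibly with the opposite orientation. -/
theorem IsTransport.segment (ha : IsTransport D x₀ z ζ a) {p q : ℝ} (hp : p ∈ Icc (0 : ℝ) 1)
    (hq : q ∈ Icc (0 : ℝ) 1) :
    IsTransport D x₀ (z + p • ζ) ((q - p) • ζ) (fun r => a (p + r * (q - p))) := by
  intro r hr
  have hmaps : MapsTo (fun r : ℝ => p + r * (q - p)) (Icc 0 1) (Icc 0 1) := by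
    intro s hs
    have := (convex_Icc (0 : ℝ) 1).add_smul_sub_mem hp hq hs
    simpa using this
  have h1 : HasDerivWithinAt (fun r : ℝ => p + r * (q - p)) (q - p) (Icc 0 1) r := by
    simpa using ((hasDerivWithinAt_id r _).mul_const (q - p)).const_add p
  have h2 := (ha _ (hmaps hr)).scomp (h := fun r : ℝ => p + r * (q - p)) r h1 hmaps
  have h3 : chartLine I x₀ (z + p • ζ) ((q - p) • ζ) r =
      chartLine I x₀ z ζ (p + r * (q - p)) := by
    simp only [chartLine, add_smul, mul_smul, add_assoc]
  have h4 := (isLinearMap_christoffel_left D x₀ (chartLine I x₀ z ζ (p + r * (q - p)))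
    (a (p + r * (q - p)))).map_smul (q - p) ζ
  simp only [h3, h4]
  rw [← smul_neg]
  exact h2

theorem IsAdapted.mdifferentiableWithinAt_chartLine (hA : IsAdapted D x₀ δ K)
    (hz : z ∈ chartBall I x₀ δ) (hζ : z + ζ ∈ chartBall I x₀ δ) {r : ℝ} (hr : r ∈ Icc (0 : ℝ) 1) :
    MDifferentiableWithinAt 𝓘(ℝ, ℝ) I (chartLine I x₀ z ζ) (Icc 0 1) r :=
  ((contMDiffOn_chartLine fun _ hs => hA.mem_target _ (add_smul_mem_chartBall hz hζ hs)) r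
    hr).mdifferentiableWithinAt (by simp)

theorem IsAdapted.mfderivWithin_chartLine (hA : IsAdapted D x₀ δ K)
    (hz : z ∈ chartBall I x₀ δ) (hζ : z + ζ ∈ chartBall I x₀ δ) {r : ℝ} (hr : r ∈ Icc (0 : ℝ) 1) :
    mfderivWithin 𝓘(ℝ, ℝ) I (chartLine I x₀ z ζ) (Icc 0 1) r (1 : ℝ) =
      coordVec x₀ ζ (chartLine I x₀ z ζ r) :=
  TensorMaxPrinciple.mfderivWithin_chartLine
    (fun _ hs => hA.mem_target _ (add_smul_mem_chartBall hz hζ hs)) hr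
    (uniqueDiffOn_Icc one_pos r hr)

theorem IsAdapted.chartLine_mem_baseSet (hA : IsAdapted D x₀ δ K)
    (hz : z ∈ chartBall I x₀ δ) (hζ : z + ζ ∈ chartBall I x₀ δ) {r : ℝ} (hr : r ∈ Icc (0 : ℝ) 1) :
    chartLine I x₀ z ζ r ∈ (trivializationAt F V x₀).baseSet :=
  hA.mem_baseSet _ (add_smul_mem_chartBall hz hζ hr)

/-- Two points of the chart ball are at distance at most `2δ`. The bound `1 / 2` makes the transport
equation solvable up to time `1`. -/
theorem IsAdapted.mul_norm_le (hA : IsAdapted D x₀ δ K)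
    (hz : z ∈ chartBall I x₀ δ) (hζ : z + ζ ∈ chartBall I x₀ δ) : K * ‖ζ‖ ≤ 1 / 2 := by
  have h1 : ‖ζ‖ ≤ 2 * δ := by
    have : ‖ζ‖ = dist (z + ζ) z := by simp [dist_eq_norm]
    rw [this]
    have h2 := dist_triangle_right (z + ζ) z (extChartAt I x₀ x₀)
    have h3 := Metric.mem_ball.1 hζ.1
    have h4 := Metric.mem_ball.1 hz.1
    linarith
  have h5 := hA.small
  nlinarith [hA.K_pos]

theorem IsAdapted.covDerivAlong_ofCoord_eq_zero (hA : IsAdapted D x₀ δ K)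
    (hz : z ∈ chartBall I x₀ δ) (hζ : z + ζ ∈ chartBall I x₀ δ) (w : F)
    {r : ℝ} (hr : r ∈ Icc (0 : ℝ) 1) :
    (ofCoord x₀ (chartLine I x₀ z ζ r)
        (-christoffel D x₀ (chartLine I x₀ z ζ r) ζ w) : V (chartLine I x₀ z ζ r)) +
      D (fun y => ofCoord x₀ y w) (chartLine I x₀ z ζ r)
        (mfderivWithin 𝓘(ℝ, ℝ) I (chartLine I x₀ z ζ) (Icc 0 1) r (1 : ℝ)) = 0 := by
  rw [map_neg, ofCoord_christoffel D (hA.chartLine_mem_baseSet hz hζ hr),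
    hA.mfderivWithin_chartLine hz hζ hr, neg_add_cancel]

variable [FiniteDimensional ℝ F] [ContMDiffVectorBundle 1 F V I]

/-- On the ball of radius `‖w‖ + 1` around `w` the speed is at most `K‖ζ‖(2‖w‖ + 1) ≤ ‖w‖ + 1 / 2`,
so Picard–Lindelöf covers all of `[0, 1]`. The estimate at time `1` makes transport continuous in
the end point at the start of the line. -/
theorem IsAdapted.exists_isTransport (hA : IsAdapted D x₀ δ K)
    (hz : z ∈ chartBall I x₀ δ) (hζ : z + ζ ∈ chartBall I x₀ δ) (w : F) :
    ∃ a, a 0 = w ∧ IsTransport D x₀ z ζ a ∧ ‖a 1 - w‖ ≤ K * ‖ζ‖ * (2 * ‖w‖ + 1) := by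
  have hKζ := hA.mul_norm_le hz hζ
  have hK := hA.K_pos
  have hline : ∀ r ∈ Icc (0 : ℝ) 1, z + r • ζ ∈ chartBall I x₀ δ :=
    fun r hr => add_smul_mem_chartBall hz hζ hr
  have hbd : ∀ t ∈ Icc (0 : ℝ) 1, ∀ x ∈ Metric.closedBall w (‖w‖ + 1),
      ‖-christoffel D x₀ (chartLine I x₀ z ζ t) ζ x‖ ≤ K * ‖ζ‖ * (2 * ‖w‖ + 1) := by
    intro t ht x hx
    rw [norm_neg]
    refine (hA.norm_le _ (hline t ht) ζ x).trans ?_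
    gcongr
    have h1 := norm_le_norm_add_norm_sub' x w
    rw [Metric.mem_closedBall, dist_eq_norm] at hx
    linarith
  have hpl : IsPicardLindelof (fun r x => -christoffel D x₀ (chartLine I x₀ z ζ r) ζ x)
      (⟨0, by simp⟩ : Icc (0 : ℝ) 1) w (‖w‖₊ + 1) 0
      (K * ‖ζ‖ * (2 * ‖w‖ + 1)).toNNReal (K * ‖ζ‖).toNNReal := by
    have hc1 : 0 ≤ K * ‖ζ‖ * (2 * ‖w‖ + 1) := by positivity
    have hc2 : 0 ≤ K * ‖ζ‖ := by positivity
    constructor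
    · intro t ht
      refine LipschitzOnWith.of_dist_le_mul fun x _ y _ => ?_
      have hlin := (isLinearMap_christoffel_right D (hA.mem_baseSet _ (hline t ht)) ζ).map_sub x y
      rw [dist_neg_neg, dist_eq_norm, dist_eq_norm, Real.coe_toNNReal _ hc2]
      refine (congrArg norm hlin).symm.trans_le ?_
      exact hA.norm_le _ (hline t ht) ζ (x - y)
    · intro x _
      have h1 : ContinuousOn (fun r : ℝ => z + r • ζ) (Icc 0 1) := by fun_prop
      exact ((hA.continuousOn ζ x).comp h1 hline).neg
    · intro t ht x hx
      rw [Real.coe_toNNReal _ hc1]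
      exact hbd t ht x (by simpa using hx)
    · rw [Real.coe_toNNReal _ hc1]
      simp
      nlinarith [norm_nonneg w]
  obtain ⟨a, ha0, ha⟩ := hpl.exists_solution_mem_closedBall (x := w) (by simp)
  refine ⟨a, ha0, fun r hr => (ha r hr).2, ?_⟩
  have := (convex_Icc (0 : ℝ) 1).norm_image_sub_le_of_norm_hasDerivWithin_le (f := a)
    (fun r hr => (ha r hr).2) (fun r hr => hbd r hr _ (by simpa using (ha r hr).1))
    (x := 0) (y := 1) (by simp) (by simp)
  simp only [sub_zero, norm_one, mul_one] at this
  have ha0' : a 0 = w := ha0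
  rwa [ha0'] at this

/-- Parallel transport along a line in a chart preserves parallel invariant sets. -/
theorem IsAdapted.ofCoord_mem_fiber (hA : IsAdapted D x₀ δ K)
    (hz : z ∈ chartBall I x₀ δ) (hζ : z + ζ ∈ chartBall I x₀ δ) (ha : IsTransport D x₀ z ζ a)
    {S : Set (TotalSpace F V)} (hS : ParallelInvariant D S)
    (h0 : ofCoord x₀ (chartLine I x₀ z ζ 0) (a 0) ∈ fiber S (chartLine I x₀ z ζ 0)) :
    ofCoord x₀ (chartLine I x₀ z ζ 1) (a 1) ∈ fiber S (chartLine I x₀ z ζ 1) := by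
  refine hS (chartLine I x₀ z ζ) (contMDiffOn_chartLine fun _ hs => hA.mem_target _
    (add_smul_mem_chartBall hz hζ hs)) (fun r => ofCoord x₀ _ (a r)) (fun r hr => ?_) h0
  have h1 := covDerivAlong_ofCoord (D := D) (hA.mdifferentiableWithinAt_chartLine hz hζ hr) hr
    (uniqueDiffOn_Icc one_pos r hr) (hA.chartLine_mem_baseSet hz hζ hr) (ha r hr)
  exact ⟨h1.1, h1.2.trans (hA.covDerivAlong_ofCoord_eq_zero hz hζ _ hr)⟩

variable [IsContMDiffRiemannianBundle I 1 F V]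

/-- Parallel transport is isometric. -/
theorem IsAdapted.inner_ofCoord_eq (hA : IsAdapted D x₀ δ K) (hD : D.IsMetricCompatible)
    (hz : z ∈ chartBall I x₀ δ) (hζ : z + ζ ∈ chartBall I x₀ δ) (ha : IsTransport D x₀ z ζ a)
    (hb : IsTransport D x₀ z ζ b) {r : ℝ} (hr : r ∈ Icc (0 : ℝ) 1) :
    inner ℝ (ofCoord x₀ (chartLine I x₀ z ζ r) (a r) : V (chartLine I x₀ z ζ r))
        (ofCoord x₀ (chartLine I x₀ z ζ r) (b r)) =
      inner ℝ (ofCoord x₀ (chartLine I x₀ z ζ 0) (a 0) : V (chartLine I x₀ z ζ 0))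
        (ofCoord x₀ (chartLine I x₀ z ζ 0) (b 0)) := by
  have h1 : ∀ s ∈ Icc (0 : ℝ) 1, HasDerivWithinAt (fun r =>
      inner ℝ (ofCoord x₀ (chartLine I x₀ z ζ r) (a r) : V (chartLine I x₀ z ζ r))
        (ofCoord x₀ (chartLine I x₀ z ζ r) (b r))) 0 (Icc 0 1) s := by
    intro s hs
    have h := hasDerivWithinAt_inner_ofCoord hD (hA.mdifferentiableWithinAt_chartLine hz hζ hs)
      (hA.chartLine_mem_baseSet hz hζ hs) (ha s hs) (hb s hs)
    rw [hA.covDerivAlong_ofCoord_eq_zero hz hζ _ hs, hA.covDerivAlong_ofCoord_eq_zero hz hζ _ hs,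
      inner_zero_left, inner_zero_right, add_zero] at h
    exact h
  have h2 := (convex_Icc (0 : ℝ) 1).norm_image_sub_le_of_norm_hasDerivWithin_le h1
    (C := 0) (by simp) (x := 0) (y := r) (by simp) hr
  rw [zero_mul] at h2
  exact sub_eq_zero.1 (norm_le_zero_iff.1 h2)

theorem IsAdapted.norm_ofCoord_eq (hA : IsAdapted D x₀ δ K) (hD : D.IsMetricCompatible)
    (hz : z ∈ chartBall I x₀ δ) (hζ : z + ζ ∈ chartBall I x₀ δ) (ha : IsTransport D x₀ z ζ a)
    {r : ℝ} (hr : r ∈ Icc (0 : ℝ) 1) :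
    ‖(ofCoord x₀ (chartLine I x₀ z ζ r) (a r) : V (chartLine I x₀ z ζ r))‖ =
      ‖(ofCoord x₀ (chartLine I x₀ z ζ 0) (a 0) : V (chartLine I x₀ z ζ 0))‖ := by
  have h := hA.inner_ofCoord_eq hD hz hζ ha ha hr
  rw [real_inner_self_eq_norm_sq, real_inner_self_eq_norm_sq] at h
  exact (sq_eq_sq₀ (norm_nonneg _) (norm_nonneg _)).1 h

/-- The derivative of the component of a section along a parallel field. -/
theorem IsAdapted.hasDerivWithinAt_inner_section (hA : IsAdapted D x₀ δ K)
    (hD : D.IsMetricCompatible) (hz : z ∈ chartBall I x₀ δ) (hζ : z + ζ ∈ chartBall I x₀ δ)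
    (ha : IsTransport D x₀ z ζ a) {r : ℝ} (hr : r ∈ Icc (0 : ℝ) 1) {σ : ∀ y, V y}
    (hσ : MDifferentiableAt I (I.prod 𝓘(ℝ, F)) (fun y => TotalSpace.mk' F y (σ y))
      (chartLine I x₀ z ζ r)) :
    HasDerivWithinAt (fun r => inner ℝ (σ (chartLine I x₀ z ζ r))
        (ofCoord x₀ (chartLine I x₀ z ζ r) (a r)))
      (inner ℝ (D σ (chartLine I x₀ z ζ r) (coordVec x₀ ζ (chartLine I x₀ z ζ r)))
        (ofCoord x₀ (chartLine I x₀ z ζ r) (a r))) (Icc 0 1) r := by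
  have h := TensorMaxPrinciple.hasDerivWithinAt_inner_section hD
    (hA.mdifferentiableWithinAt_chartLine hz hζ hr) hr
    (hA.chartLine_mem_baseSet hz hζ hr) hσ (ha r hr)
  rw [hA.covDerivAlong_ofCoord_eq_zero hz hζ _ hr, hA.mfderivWithin_chartLine hz hζ hr,
    inner_zero_right, add_zero] at h
  exact h

/-- The distance to a parallel invariant set is bounded below by a component along a
parallel field, if this is so for the distances from the supporting point. -/
theorem IsAdapted.inner_sub_le_infDist (hA : IsAdapted D x₀ δ K)
    (hD : D.IsMetricCompatible) (hz : z ∈ chartBall I x₀ δ) (hζ : z + ζ ∈ chartBall I x₀ δ)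
    {S : Set (TotalSpace F V)} (hS : ParallelInvariant D S) (hne : ∀ x, (fiber S x).Nonempty)
    (hb : IsTransport D x₀ z ζ b) {c : ℝ}
    (hsup : ∀ q ∈ fiber S (chartLine I x₀ z ζ 0),
      inner ℝ q (ofCoord x₀ (chartLine I x₀ z ζ 0) (b 0)) ≤ c) {r : ℝ} (hr : r ∈ Icc (0 : ℝ) 1)
    (u : V (chartLine I x₀ z ζ r)) :
    inner ℝ u (ofCoord x₀ (chartLine I x₀ z ζ r) (b r)) - c ≤
      ‖(ofCoord x₀ (chartLine I x₀ z ζ 0) (b 0) : V (chartLine I x₀ z ζ 0))‖ *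
        Metric.infDist u (fiber S (chartLine I x₀ z ζ r)) := by
  revert u
  set y := chartLine I x₀ z ζ r with hy
  intro u
  set x := chartLine I x₀ z ζ 0 with hx
  set n : ℝ := ‖(ofCoord x₀ x (b 0) : V x)‖ with hn
  have hy' : y ∈ (trivializationAt F V x₀).baseSet := hA.chartLine_mem_baseSet hz hζ hr
  have hny : ‖(ofCoord x₀ y (b r) : V y)‖ = n := hA.norm_ofCoord_eq hD hz hζ hb hr
  -- Transport `q` back to `x` along the reversed segment: it stays in `S` and its inner product
  -- with the parallel field is unchanged, so the supporting inequality at `x` applies.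
  have hq : ∀ q ∈ fiber S y, inner ℝ q (ofCoord x₀ y (b r)) ≤ c := by
    intro q hq
    have hz' : z + r • ζ ∈ chartBall I x₀ δ := add_smul_mem_chartBall hz hζ hr
    have hζ' : z + r • ζ + (0 - r) • ζ ∈ chartBall I x₀ δ := by
      simpa using hz
    have hb' := hb.segment hr (q := 0) (by simp)
    obtain ⟨e, he0, he, -⟩ := hA.exists_isTransport hz' hζ' (toCoord F x₀ y q)
    have e0 : chartLine I x₀ (z + r • ζ) ((0 - r) • ζ) 0 = y := by simp [chartLine, hy]
    have e1 : chartLine I x₀ (z + r • ζ) ((0 - r) • ζ) 1 = x := by simp [chartLine, hx]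
    have h1 := hA.ofCoord_mem_fiber hz' hζ' he hS
    rw [e0, e1, he0, ofCoord_toCoord hy'] at h1
    have h2 := hA.inner_ofCoord_eq hD hz' hζ' he hb' (r := 1) (by simp)
    have h3 : r + (0 - r) = 0 := by ring
    simp only [he0, zero_mul, add_zero, one_mul, h3] at h2
    rw [e0, e1, ofCoord_toCoord hy'] at h2
    rw [← h2]
    exact hsup _ (h1 hq)
  have hkey : ∀ q ∈ fiber S y, inner ℝ u (ofCoord x₀ y (b r)) - c ≤ n * dist u q := by
    intro q hqS
    have h1 := hq q hqS
    have h2 := real_inner_le_norm (u - q) (ofCoord x₀ y (b r))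
    rw [inner_sub_left, hny] at h2
    rw [dist_eq_norm]
    linarith
  rcases (norm_nonneg (ofCoord x₀ x (b 0) : V x)).eq_or_lt with h0 | h0
  · obtain ⟨q, hqS⟩ := hne y
    have := hkey q hqS
    rw [hn, ← h0, zero_mul] at this ⊢
    exact this
  · rw [mul_comm, ← div_le_iff₀ h0]
    refine (Metric.le_infDist (hne y)).2 fun q hqS => ?_
    rw [div_le_iff₀ h0, mul_comm]
    exact hkey q hqS

end Transport

/-! ### First and second order conditions at a spatial maximum of the distance -/

section Spatial

variable {E : Type*} [NormedAddCommGroup E] [NormedSpace ℝ E] [FiniteDimensional ℝ E]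
  {H : Type*} [TopologicalSpace H] {I : ModelWithCorners ℝ E H}
  {M : Type*} [TopologicalSpace M] [ChartedSpace H M] [IsManifold I ∞ M]
  {F : Type*} [NormedAddCommGroup F] [NormedSpace ℝ F] [FiniteDimensional ℝ F]
  {V : M → Type*} [TopologicalSpace (TotalSpace F V)]
  [∀ x, NormedAddCommGroup (V x)] [∀ x, InnerProductSpace ℝ (V x)]
  [FiberBundle F V] [VectorBundle ℝ F V]
  {D : CovariantDerivative I F V}

omit [FiniteDimensional ℝ F] in
/-- If the derivative of `σ` at `x` is orthogonal to `N`, then the `N`-component of the iterated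
derivative `D_W D_X σ` at `x` only depends on the values of `X` and `W` at `x`. -/
theorem inner_covDeriv_covDeriv_congr (hD : ContMDiffCovariantDerivativeOn F ∞ D.toFun univ)
    {σ : ∀ y, V y} (hσ : ContMDiff I (I.prod 𝓘(ℝ, F)) ∞ (fun y => TotalSpace.mk' F y (σ y)))
    {x : M} {N : V x} (hN : ∀ X : TangentSpace I x, inner ℝ (D σ x X) N = 0)
    {X X' : ∀ y : M, TangentSpace I y}
    (hX : MDifferentiableAt I I.tangent (fun y => (⟨y, X y⟩ : TangentBundle I M)) x)
    (hX' : MDifferentiableAt I I.tangent (fun y => (⟨y, X' y⟩ : TangentBundle I M)) x)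
    (hXX' : X x = X' x) (W : TangentSpace I x) :
    inner ℝ (D (fun y => D σ y (X y)) x W) N = inner ℝ (D (fun y => D σ y (X' y)) x W) N := by
  have h1 := ((hD.contMDiff (σ := σ) (by simpa using hσ.contMDiffOn)).contMDiffAt
    (x := x) (by simp)).mdifferentiableAt (by simp)
  have hd : ∀ {Z : ∀ y : M, TangentSpace I y},
      MDifferentiableAt I I.tangent (fun y => (⟨y, Z y⟩ : TangentBundle I M)) x →
      MDifferentiableAt I (I.prod 𝓘(ℝ, F)) (fun y => TotalSpace.mk' F y (D σ y (Z y))) x :=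
    fun hZ => MDifferentiableAt.clm_bundle_apply h1 hZ
  have hten : TensorialAt I E
      (fun Z : ∀ y : M, TangentSpace I y => inner ℝ (D (fun y => D σ y (Z y)) x W) N) x := by
    constructor
    · intro g Z hg hZ
      have h2 : (fun y => D σ y ((g • Z) y)) = g • fun y => D σ y (Z y) := by
        funext y; simp
      rw [h2, D.isCovariantDerivativeOn.leibniz (s := univ) (hd hZ) hg]
      -- The term of the Leibniz rule that differentiates `g` is a multiple of `D σ x (Z x)`, which
      -- is orthogonal to `N`.
      simp [inner_add_left, inner_smul_left, hN]
    · intro Z Z' hZ hZ'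
      have h2 : (fun y => D σ y ((Z + Z') y)) =
          (fun y => D σ y (Z y)) + fun y => D σ y (Z' y) := by
        funext y; simp
      rw [h2, D.isCovariantDerivativeOn.add (s := univ) (hd hZ) (hd hZ')]
      simp [inner_add_left]
  exact hten.pointwise hX hX' hXX'

variable [T2Space M] [ContMDiffVectorBundle ∞ F V I] [IsContMDiffRiemannianBundle I 1 F V]
  {x : M} {ζ : E} {δ K : ℝ} {S : Set (TotalSpace F V)}

-- Replaces the distance, which need not be differentiable, by a function differentiable along the
-- line with a maximum at `0`: with `c = ⟪v, σ x - v⟫`, it is at most `c + ‖σ x - v‖` times the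
-- distance, with equality at `r = 0`.
omit [FiniteDimensional ℝ E] [T2Space M] in
theorem IsAdapted.exists_transport_inner_le (hA : IsAdapted D x δ K)
    (hDm : D.IsMetricCompatible) (hS : ParallelInvariant D S) (hne : ∀ x, (fiber S x).Nonempty)
    (hconv : Convex ℝ (fiber S x)) {σ : ∀ y, V y}
    (hmax : ∀ y, Metric.infDist (σ y) (fiber S y) ≤ Metric.infDist (σ x) (fiber S x))
    {v : V x} (hv : v ∈ fiber S x) (hd : dist (σ x) v = Metric.infDist (σ x) (fiber S x))
    (hζ : extChartAt I x x + ζ ∈ chartBall I x δ) :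
    ∃ b : ℝ → F, b 0 = toCoord F x x (σ x - v) ∧ IsTransport D x (extChartAt I x x) ζ b ∧
      ∀ r ∈ Icc (0 : ℝ) 1, inner ℝ (σ (chartLine I x (extChartAt I x x) ζ r))
          (ofCoord x (chartLine I x (extChartAt I x x) ζ r) (b r)) ≤
        inner ℝ (σ (chartLine I x (extChartAt I x x) ζ 0))
          (ofCoord x (chartLine I x (extChartAt I x x) ζ 0) (b 0)) := by
  have hz : extChartAt I x x ∈ chartBall I x δ :=
    ⟨Metric.mem_ball_self hA.pos, extChartAt_target_subset_range x (mem_extChartAt_target x)⟩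
  obtain ⟨b, hb0, hb, -⟩ := hA.exists_isTransport hz hζ (toCoord F x x (σ x - v))
  refine ⟨b, hb0, hb, fun r hr => ?_⟩
  have hγ : chartLine I x (extChartAt I x x) ζ 0 = x := by simp [chartLine]
  have hx : x ∈ (trivializationAt F V x).baseSet := mem_baseSet_trivializationAt F V x
  have h1 := hA.inner_sub_le_infDist hDm hz hζ hS hne hb (c := inner ℝ v (σ x - v)) (by
    rw [hγ, hb0, ofCoord_toCoord hx]
    intro q hq
    have := inner_nearest_nonpos hconv hv hd q hq
    rw [real_inner_comm, inner_sub_left] at this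
    linarith) hr (σ _)
  rw [hγ, hb0, ofCoord_toCoord hx]
  rw [hγ, hb0, ofCoord_toCoord hx] at h1
  have h2 := hmax (chartLine I x (extChartAt I x x) ζ r)
  rw [← hd, dist_eq_norm] at h2
  have h3 : inner ℝ (σ x) (σ x - v) = inner ℝ v (σ x - v) + ‖σ x - v‖ * ‖σ x - v‖ := by
    rw [← real_inner_self_eq_norm_mul_norm, ← inner_add_left, add_sub_cancel]
  rw [h3]
  have h4 := mul_le_mul_of_nonneg_left h2 (norm_nonneg (σ x - v))
  linarith

omit [FiniteDimensional ℝ E] [IsManifold I ∞ M] [T2Space M] in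
theorem exists_add_smul_mem_chartBall (hδ : 0 < δ) {ε : ℝ} (hε : 0 < ε)
    (h : extChartAt I x x + ε • ζ ∈ range I) :
    ∃ c > (0 : ℝ), extChartAt I x x + c • ζ ∈ chartBall I x δ := by
  have h1 : Tendsto (fun c : ℝ => extChartAt I x x + c • ζ) (𝓝[>] 0) (𝓝 (extChartAt I x x)) := by
    have : Continuous (fun c : ℝ => extChartAt I x x + c • ζ) := by fun_prop
    simpa using (this.tendsto 0).mono_left nhdsWithin_le_nhds
  have h2 := h1.eventually (Metric.ball_mem_nhds _ hδ)
  obtain ⟨c, ⟨hcb, hcε⟩, hc0⟩ := ((h2.and (Ioo_mem_nhdsGT hε)).and self_mem_nhdsWithin).exists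
  refine ⟨c, hc0, hcb, ?_⟩
  have h3 := I.convex_range.add_smul_mem (extChartAt_target_subset_range x
    (mem_extChartAt_target (I := I) x)) h (t := c / ε)
    ⟨by positivity, (div_le_one hε).2 hcε.2.le⟩
  rwa [smul_smul, div_mul_cancel₀ _ hε.ne'] at h3

/-- At a maximum of the distance, the derivative in the inward directions has nonpositive
component along the outward normal of the fibre. -/
theorem inner_covDeriv_nonpos_of_max (hD : ContMDiffCovariantDerivativeOn F ∞ D.toFun univ)
    (hDm : D.IsMetricCompatible) (hS : ParallelInvariant D S) (hne : ∀ x, (fiber S x).Nonempty)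
    (hconv : Convex ℝ (fiber S x)) {σ : ∀ y, V y}
    (hσ : ContMDiff I (I.prod 𝓘(ℝ, F)) ∞ (fun y => TotalSpace.mk' F y (σ y)))
    (hmax : ∀ y, Metric.infDist (σ y) (fiber S y) ≤ Metric.infDist (σ x) (fiber S x))
    {v : V x} (hv : v ∈ fiber S x) (hd : dist (σ x) v = Metric.infDist (σ x) (fiber S x))
    {ε : ℝ} (hε : 0 < ε) (hζ : extChartAt I x x + ε • ζ ∈ range I) :
    inner ℝ (D σ x (coordVec x ζ x)) (σ x - v) ≤ 0 := by
  obtain ⟨δ, K, hA⟩ := exists_isAdapted hD x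
  obtain ⟨c, hc, hcζ⟩ := exists_add_smul_mem_chartBall hA.pos hε hζ
  obtain ⟨b, hb0, hb, hle⟩ := hA.exists_transport_inner_le hDm hS hne hconv hmax hv hd hcζ
  have hz : extChartAt I x x ∈ chartBall I x δ :=
    ⟨Metric.mem_ball_self hA.pos, extChartAt_target_subset_range x (mem_extChartAt_target x)⟩
  have hγ : chartLine I x (extChartAt I x x) (c • ζ) 0 = x := by simp [chartLine]
  have hx : x ∈ (trivializationAt F V x).baseSet := mem_baseSet_trivializationAt F V x
  have h1 := nonpos_of_deriv_of_max hle (hA.hasDerivWithinAt_inner_section hDm hz hcζ hb (by simp)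
    (hσ.mdifferentiableAt (by simp)))
  rw [hγ, hb0, ofCoord_toCoord hx] at h1
  have h2 : coordVec (I := I) x (c • ζ) x = c • coordVec (I := I) x ζ x := by simp [coordVec]
  rw [h2, map_smul, real_inner_smul_left] at h1
  exact nonpos_of_mul_nonpos_right h1 hc

/-- At a maximum of the distance where the derivative is orthogonal to the normal of the fibre,
the second covariant derivatives have nonpositive component along that normal. -/
theorem inner_secondCovDeriv_nonpos_of_max
    (hD : ContMDiffCovariantDerivativeOn F ∞ D.toFun univ)
    (hDm : D.IsMetricCompatible) (hS : ParallelInvariant D S) (hne : ∀ x, (fiber S x).Nonempty)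
    (hconv : Convex ℝ (fiber S x)) {σ : ∀ y, V y}
    (hσ : ContMDiff I (I.prod 𝓘(ℝ, F)) ∞ (fun y => TotalSpace.mk' F y (σ y)))
    (hmax : ∀ y, Metric.infDist (σ y) (fiber S y) ≤ Metric.infDist (σ x) (fiber S x))
    {v : V x} (hv : v ∈ fiber S x) (hd : dist (σ x) v = Metric.infDist (σ x) (fiber S x))
    (hN : ∀ X : TangentSpace I x, inner ℝ (D σ x X) (σ x - v) = 0)
    (hrange : ∀ ζ : E, ∃ ε > (0 : ℝ), extChartAt I x x + ε • ζ ∈ range I ∨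
      extChartAt I x x + ε • (-ζ) ∈ range I)
    (nabla : CovariantDerivative I E (fun x : M => TangentSpace I x))
    {X : ∀ y : M, TangentSpace I y}
    (hX : ContMDiffAt I I.tangent ∞ (fun y => (⟨y, X y⟩ : TangentBundle I M)) x) :
    inner ℝ (secondCovDeriv D nabla X σ x) (σ x - v) ≤ 0 := by
  obtain ⟨δ, K, hA⟩ := exists_isAdapted hD x
  have hz : extChartAt I x x ∈ chartBall I x δ :=
    ⟨Metric.mem_ball_self hA.pos, extChartAt_target_subset_range x (mem_extChartAt_target x)⟩
  have hxs : x ∈ (chartAt H x).source := mem_chart_source H x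
  have hx : x ∈ (trivializationAt F V x).baseSet := mem_baseSet_trivializationAt F V x
  -- For a field with constant coordinates the test applies along its own line. Shortening the
  -- direction to `c • ζ` multiplies the second derivative by `c²`, which is divided out.
  have key : ∀ ζ : E, ∀ ε > (0 : ℝ), extChartAt I x x + ε • ζ ∈ range I →
      inner ℝ (D (fun y => D σ y (coordVec x ζ y)) x (coordVec x ζ x)) (σ x - v) ≤ 0 := by
    intro ζ ε hε hζ
    obtain ⟨c, hc, hcζ⟩ := exists_add_smul_mem_chartBall hA.pos hε hζ
    obtain ⟨b, hb0, hb, hle⟩ := hA.exists_transport_inner_le hDm hS hne hconv hmax hv hd hcζ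
    have hγ : chartLine I x (extChartAt I x x) (c • ζ) 0 = x := by simp [chartLine]
    have hsm := contMDiffAt_covDeriv hD hσ (contMDiffAt_coordVec (I := I) (c • ζ) hxs)
    have h1 := nonpos_of_second_deriv_of_max hle
      (fun r hr => hA.hasDerivWithinAt_inner_section hDm hz hcζ hb hr
        (hσ.mdifferentiableAt (by simp)))
      (by rw [hγ, hb0, ofCoord_toCoord hx]; exact hN _)
      (hA.hasDerivWithinAt_inner_section hDm hz hcζ hb (by simp)
        (σ := fun y => D σ y (coordVec x (c • ζ) y))
        (by rw [hγ]; exact hsm.mdifferentiableAt (by simp)))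
    rw [hγ, hb0, ofCoord_toCoord hx] at h1
    have h2 : ∀ y, coordVec (I := I) x (c • ζ) y = c • coordVec (I := I) x ζ y := by
      simp [coordVec]
    have h3 : (fun y => D σ y (coordVec x (c • ζ) y)) = c • fun y => D σ y (coordVec x ζ y) := by
      funext y; simp [h2]
    have hsm' := contMDiffAt_covDeriv hD hσ (contMDiffAt_coordVec (I := I) ζ hxs)
    have h4 := D.isCovariantDerivativeOn.smul_const c (hsm'.mdifferentiableAt (by simp))
      (mem_univ x)
    rw [h3, h2] at h1
    erw [h4] at h1
    rw [map_smul, real_inner_smul_left, smul_apply, real_inner_smul_left] at h1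
    exact nonpos_of_mul_nonpos_right (nonpos_of_mul_nonpos_right h1 hc) hc
  obtain ⟨ζ, hζ⟩ := exists_coordVec_eq hxs (X x)
  -- First derivatives have no normal component, so the term with `nabla` drops and `X` may be
  -- replaced by the field with constant coordinates. The result is even in `ζ`, so one admissible
  -- sign suffices.
  rw [secondCovDeriv, inner_sub_left, hN, sub_zero,
    inner_covDeriv_covDeriv_congr hD hσ hN (hX.mdifferentiableAt (by simp))
      ((contMDiffAt_coordVec ζ hxs).mdifferentiableAt (by simp)) hζ, hζ]
  obtain ⟨ε, hε, h | h⟩ := hrange ζ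
  · exact key ζ ε hε h
  · have h1 := key (-ζ) ε hε h
    have h2 : ∀ y, coordVec (I := I) x (-ζ) y = (-1 : ℝ) • coordVec (I := I) x ζ y := by
      simp [coordVec]
    have h3 : (fun y => D σ y (coordVec x (-ζ) y)) = (-1 : ℝ) • fun y => D σ y (coordVec x ζ y) := by
      funext y; simp [h2]
    have hsm' := contMDiffAt_covDeriv hD hσ (contMDiffAt_coordVec (I := I) ζ hxs)
    have h4 := D.isCovariantDerivativeOn.smul_const (-1 : ℝ) (hsm'.mdifferentiableAt (by simp))
      (mem_univ x)
    rw [h3, h2] at h1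
    erw [h4] at h1
    rw [map_smul, real_inner_smul_left, smul_apply, real_inner_smul_left] at h1
    linarith

end Spatial

/-! ### Upper semicontinuity of the distance -/

section Semicontinuity

variable {E : Type*} [NormedAddCommGroup E] [NormedSpace ℝ E] [FiniteDimensional ℝ E]
  {H : Type*} [TopologicalSpace H] {I : ModelWithCorners ℝ E H}
  {M : Type*} [TopologicalSpace M] [ChartedSpace H M] [IsManifold I ∞ M] [T2Space M]
  {F : Type*} [NormedAddCommGroup F] [NormedSpace ℝ F] [FiniteDimensional ℝ F]
  {V : M → Type*} [TopologicalSpace (TotalSpace F V)]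
  [∀ x, NormedAddCommGroup (V x)] [∀ x, InnerProductSpace ℝ (V x)]
  [FiberBundle F V] [VectorBundle ℝ F V] [ContMDiffVectorBundle ∞ F V I]
  [IsContMDiffRiemannianBundle I 1 F V] {D : CovariantDerivative I F V}
  {S : Set (TotalSpace F V)}

/-- Points of a parallel invariant set extend to continuous local sections of constant norm. -/
theorem exists_continuousAt_mem_fiber (hD : ContMDiffCovariantDerivativeOn F ∞ D.toFun univ)
    (hDm : D.IsMetricCompatible) (hS : ParallelInvariant D S) {x : M} {v : V x}
    (hv : v ∈ fiber S x) :
    ∃ n : M → F, ContinuousAt n x ∧ n x = toCoord F x x v ∧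
      ∀ᶠ y in 𝓝 x, ofCoord x y (n y) ∈ fiber S y ∧ ‖(ofCoord x y (n y) : V y)‖ = ‖v‖ := by
  obtain ⟨δ, K, hA⟩ := exists_isAdapted hD x
  set z₀ := extChartAt I x x with hz₀
  have hz : z₀ ∈ chartBall I x δ :=
    ⟨Metric.mem_ball_self hA.pos, extChartAt_target_subset_range x (mem_extChartAt_target x)⟩
  have hx : x ∈ (trivializationAt F V x).baseSet := mem_baseSet_trivializationAt F V x
  -- The local section is radial: `v` is transported to `y` along the chart line from `x`. The
  -- estimate by the length of that line gives continuity at `x`, the only point where it is needed.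
  have hex : ∀ y : M, ∃ w : F, extChartAt I x y ∈ chartBall I x δ → y ∈ (extChartAt I x).source →
      ‖w - toCoord F x x v‖ ≤ K * ‖extChartAt I x y - z₀‖ * (2 * ‖toCoord F x x v‖ + 1) ∧
      ofCoord x y w ∈ fiber S y ∧ ‖(ofCoord x y w : V y)‖ = ‖v‖ := by
    intro y
    by_cases hy : extChartAt I x y ∈ chartBall I x δ ∧ y ∈ (extChartAt I x).source
    · have hζ : z₀ + (extChartAt I x y - z₀) ∈ chartBall I x δ := by
        rw [add_sub_cancel]; exact hy.1
      obtain ⟨a, ha0, ha, hle⟩ := hA.exists_isTransport hz hζ (toCoord F x x v)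
      have e0 : chartLine I x z₀ (extChartAt I x y - z₀) 0 = x := by simp [chartLine, hz₀]
      have e1 : chartLine I x z₀ (extChartAt I x y - z₀) 1 = y := by
        rw [chartLine, one_smul, add_sub_cancel, (extChartAt I x).left_inv hy.2]
      have h1 := hA.ofCoord_mem_fiber hz hζ ha hS
      have h2 := hA.norm_ofCoord_eq hDm hz hζ ha (r := 1) (by simp)
      rw [e0, e1, ha0, ofCoord_toCoord hx] at h1 h2
      exact ⟨a 1, fun _ _ => ⟨hle, h1 hv, h2⟩⟩
    · exact ⟨0, fun h1 h2 => absurd ⟨h1, h2⟩ hy⟩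
  choose n hn using hex
  have hcont : ContinuousAt (extChartAt I x) x := continuousAt_extChartAt x
  have hev : ∀ᶠ y in 𝓝 x, extChartAt I x y ∈ chartBall I x δ ∧ y ∈ (extChartAt I x).source := by
    filter_upwards [hcont.tendsto.eventually (Metric.ball_mem_nhds _ hA.pos),
      extChartAt_source_mem_nhds (I := I) x] with y h1 h2
    exact ⟨⟨h1, extChartAt_target_subset_range x ((extChartAt I x).map_source h2)⟩, h2⟩
  have hnx : n x = toCoord F x x v := by
    have := (hn x hz (mem_extChartAt_source x)).1
    rw [hz₀, sub_self, norm_zero, mul_zero, zero_mul] at this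
    exact sub_eq_zero.1 (norm_le_zero_iff.1 this)
  refine ⟨n, ?_, hnx, hev.mono fun y hy => (hn y hy.1 hy.2).2⟩
  rw [ContinuousAt, hnx, tendsto_iff_norm_sub_tendsto_zero]
  have hlim : Tendsto (fun y => K * ‖extChartAt I x y - z₀‖ * (2 * ‖toCoord F x x v‖ + 1)) (𝓝 x)
      (𝓝 0) := by
    have h1 := (tendsto_iff_norm_sub_tendsto_zero.1 hcont.tendsto)
    simpa only [mul_zero, zero_mul] using (h1.const_mul K).mul_const (2 * ‖toCoord F x x v‖ + 1)
  refine squeeze_zero' (Eventually.of_forall fun _ => norm_nonneg _) ?_ hlim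
  exact hev.mono fun y hy => (hn y hy.1 hy.2).1

/-- A nearest point at `(t₀, x)` extends to a section of `C t₀` of constant norm, hence bounded, and
Hausdorff continuity puts it within `ε` of the fibres of `C t`. This competitor bounds the distance
from above. Only the connection at time `t₀` enters, so no regularity of the connections in time is
required. -/
theorem upperSemicontinuousWithinAt_infDist
    {C : ℝ → Set (TotalSpace F V)} {J : Set ℝ} (hC : PointedHausdorffContinuousOn C J)
    {t₀ : ℝ} (ht₀ : t₀ ∈ J) (hD : ContMDiffCovariantDerivativeOn F ∞ D.toFun univ)
    (hDm : D.IsMetricCompatible) (hS : ParallelInvariant D (C t₀)) {x : M}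
    (hne : (fiber (C t₀) x).Nonempty) (hcl : IsClosed (fiber (C t₀) x)) {f : ℝ → ∀ x : M, V x}
    (hf : ContinuousOn (fun p : ℝ × M => TotalSpace.mk' F p.2 (f p.1 p.2)) (J ×ˢ univ)) :
    UpperSemicontinuousWithinAt
      (fun p : ℝ × M => Metric.infDist (f p.1 p.2) (fiber (C p.1) p.2)) (J ×ˢ univ) (t₀, x) := by
  have hR : IsContinuousRiemannianBundle F V :=
    isContinuousRiemannianBundle (I := I) inferInstance
  have := finiteDimensional_fiber F (V := V) x
  have : ProperSpace (V x) := FiniteDimensional.proper ℝ (V x)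
  intro c hc
  dsimp only at hc
  obtain ⟨v, hv, hvd⟩ := hcl.exists_infDist_eq_dist hne (f t₀ x)
  obtain ⟨n, hn, hnx, hnS⟩ := exists_continuousAt_mem_fiber hD hDm hS hv
  have hx : x ∈ (trivializationAt F V x).baseSet := mem_baseSet_trivializationAt F V x
  set ε := (c - Metric.infDist (f t₀ x) (fiber (C t₀) x)) / 2 with hε
  have hε0 : 0 < ε := by rw [hε]; linarith
  have hsnd : Tendsto (Prod.snd : ℝ × M → M) (𝓝[J ×ˢ univ] (t₀, x)) (𝓝 x) :=
    (continuous_snd.tendsto (t₀, x)).mono_left nhdsWithin_le_nhds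
  have hfst : Tendsto (Prod.fst : ℝ × M → ℝ) (𝓝[J ×ˢ univ] (t₀, x)) (𝓝[J] t₀) :=
    tendsto_nhdsWithin_iff.2 ⟨(continuous_fst.tendsto (t₀, x)).mono_left nhdsWithin_le_nhds,
      eventually_nhdsWithin_of_forall fun p hp => hp.1⟩
  have hq : ContinuousWithinAt
      (fun p : ℝ × M => TotalSpace.mk' F p.2 (ofCoord x p.2 (n p.2) : V p.2)) (J ×ˢ univ)
      (t₀, x) :=
    continuousWithinAt_ofCoord (b := fun p : ℝ × M => p.2) (n := fun p => n p.2)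
      continuous_snd.continuousWithinAt
      (ContinuousAt.comp_continuousWithinAt (f := Prod.snd) (x := (t₀, x)) hn
        continuous_snd.continuousWithinAt) hx
  have h1 := continuousWithinAt_norm_sub (hf (t₀, x) ⟨ht₀, mem_univ _⟩) hq
  have h2 : ‖f t₀ x - (ofCoord x x (n x) : V x)‖ < Metric.infDist (f t₀ x) (fiber (C t₀) x) + ε := by
    rw [hnx, ofCoord_toCoord hx, ← dist_eq_norm, ← hvd]
    linarith
  filter_upwards [h1.eventually (gt_mem_nhds h2), hsnd.eventually hnS,
    hfst.eventually (hC t₀ ht₀ (‖v‖ + 1) (by positivity) ε hε0)] with p hp1 hp2 hp3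
  have h3 := (hp3 p.2).2 _ hp2.1 (by rw [hp2.2]; linarith)
  have h4 := Metric.infDist_le_infDist_add_dist (s := fiber (C p.1) p.2) (x := f p.1 p.2)
    (y := ofCoord x p.2 (n p.2))
  rw [dist_eq_norm] at h4
  linarith

end Semicontinuity

/-! ### The exterior normal and inward directions -/

section Boundary

variable {n : ℕ} [NeZero n] {M : Type*} [TopologicalSpace M]
    [ChartedSpace (EuclideanHalfSpace n) M] [IsManifold (𝓡∂ n) ∞ M]

theorem mvfderiv_extChartAt_coordVec (x : M) (ζ : EuclideanSpace ℝ (Fin n)) :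
    mvfderiv (𝓡∂ n) (fun y : M => extChartAt (𝓡∂ n) x y 0) x (coordVec x ζ x) = ζ 0 := by
  have hs : x ∈ (chartAt (EuclideanHalfSpace n) x).source := mem_chart_source _ x
  have h1 : HasMFDerivAt (𝓡∂ n) 𝓘(ℝ, EuclideanSpace ℝ (Fin n)) (extChartAt (𝓡∂ n) x) x
      (mfderiv (𝓡∂ n) 𝓘(ℝ, EuclideanSpace ℝ (Fin n)) (extChartAt (𝓡∂ n) x) x) :=
    (mdifferentiableAt_extChartAt hs).hasMFDerivAt
  have h2 : HasMFDerivAt 𝓘(ℝ, EuclideanSpace ℝ (Fin n)) 𝓘(ℝ, ℝ)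
      (fun z : EuclideanSpace ℝ (Fin n) => z 0) (extChartAt (𝓡∂ n) x x)
      (EuclideanSpace.proj (0 : Fin n) : EuclideanSpace ℝ (Fin n) →L[ℝ] ℝ) :=
    (EuclideanSpace.proj (0 : Fin n) : EuclideanSpace ℝ (Fin n) →L[ℝ] ℝ).hasFDerivAt.hasMFDerivAt
  have h3 := (h2.comp x h1).mfderiv
  have h4 : mfderiv (𝓡∂ n) 𝓘(ℝ, EuclideanSpace ℝ (Fin n)) (extChartAt (𝓡∂ n) x) x
      (coordVec x ζ x) = ζ := by
    have hb : x ∈ (trivializationAt (EuclideanSpace ℝ (Fin n))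
        (TangentSpace (𝓡∂ n) : M → Type _) x).baseSet := by
      rwa [TangentBundle.trivializationAt_baseSet]
    rw [← TangentBundle.continuousLinearMapAt_trivializationAt hs, coordVec]
    exact Trivialization.continuousLinearMapAt_symmL (R := ℝ) _ hb ζ
  have h5 : (fun y : M => extChartAt (𝓡∂ n) x y 0) =
    (fun z : EuclideanSpace ℝ (Fin n) => z 0) ∘ (extChartAt (𝓡∂ n) x) := rfl
  rw [mvfderiv, h5, h3]
  exact congrArg (fun z : EuclideanSpace ℝ (Fin n) => z 0) h4

/-- The normal is minus the normalized `g`-gradient `u` of the boundary defining coordinate; the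
gradient exists because `g` is nondegenerate in finite dimension, and it is nonzero since the zeroth
basis vector has derivative `1`. -/
theorem exists_isExteriorUnitNormal (g : ContMDiffRiemannianMetric (𝓡∂ n) ∞
    (EuclideanSpace ℝ (Fin n)) (fun x : M => TangentSpace (𝓡∂ n) x)) (x : M) :
    ∃ ν, IsExteriorUnitNormal g x ν := by
  set ℓ : TangentSpace (𝓡∂ n) x →L[ℝ] ℝ :=
    mvfderiv (𝓡∂ n) (fun y : M => extChartAt (𝓡∂ n) x y 0) x with hℓ
  let B : TangentSpace (𝓡∂ n) x →ₗ[ℝ] (TangentSpace (𝓡∂ n) x →ₗ[ℝ] ℝ) :=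
    { toFun := fun u => (g.inner x u).toLinearMap
      map_add' := fun u w => by ext; simp
      map_smul' := fun c u => by ext; simp }
  have : FiniteDimensional ℝ (TangentSpace (𝓡∂ n) x) :=
    inferInstanceAs (FiniteDimensional ℝ (EuclideanSpace ℝ (Fin n)))
  have hinj : Function.Injective B := by
    refine (injective_iff_map_eq_zero B).2 fun u hu => ?_
    by_contra hne
    have h1 := g.pos x u hne
    have h2 : g.inner x u u = 0 := LinearMap.congr_fun hu u
    linarith
  have hsurj : Function.Surjective B :=
    (LinearMap.injective_iff_surjective_of_finrank_eq_finrank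
      (Subspace.dual_finrank_eq (K := ℝ) (V := TangentSpace (𝓡∂ n) x)).symm).1 hinj
  obtain ⟨u, hu⟩ := hsurj ℓ.toLinearMap
  have hu' : ∀ w, g.inner x u w = ℓ w := fun w => LinearMap.congr_fun hu w
  have hune : u ≠ 0 := by
    rintro rfl
    have h1 := mvfderiv_extChartAt_coordVec x (EuclideanSpace.single (0 : Fin n) (1 : ℝ))
    have h2 := hu' (coordVec x (EuclideanSpace.single (0 : Fin n) (1 : ℝ)) x)
    rw [hℓ, h1] at h2
    simp at h2
  have hpos := g.pos x u hune
  set c := (Real.sqrt (g.inner x u u))⁻¹ with hc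
  have hc0 : 0 < c := by positivity
  have hcc : c * c * g.inner x u u = 1 := by
    rw [hc, ← mul_inv, Real.mul_self_sqrt hpos.le, inv_mul_cancel₀ hpos.ne']
  refine ⟨-(c • u), ?_, ?_, ?_⟩
  · simpa [mul_assoc] using hcc
  · intro w hw
    have h1 := hu' w
    have h2 : ℓ w = 0 := hw
    simp [h1, h2]
  · change ℓ (-(c • u)) < 0
    rw [map_neg, map_smul, ← hu', smul_eq_mul, neg_lt_zero]
    positivity

omit [IsManifold (𝓡∂ n) ∞ M] in
theorem exists_add_smul_mem_range (x : M) (ζ : EuclideanSpace ℝ (Fin n))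
    (h : 0 ≤ ζ 0 ∨ x ∉ (𝓡∂ n).boundary M) :
    ∃ ε > (0 : ℝ), extChartAt (𝓡∂ n) x x + ε • ζ ∈ range (𝓡∂ n) := by
  have hz : extChartAt (𝓡∂ n) x x ∈ range (𝓡∂ n) :=
    extChartAt_target_subset_range x (mem_extChartAt_target x)
  rcases h with h | h
  · refine ⟨1, one_pos, ?_⟩
    rw [range_modelWithCornersEuclideanHalfSpace] at hz ⊢
    have hz' : 0 ≤ extChartAt (𝓡∂ n) x x 0 := hz
    simpa using add_nonneg hz' h
  · have hi : (𝓡∂ n).IsInteriorPoint x := by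
      by_contra hi
      exact h ((𝓡∂ n).isBoundaryPoint_iff_not_isInteriorPoint x |>.2 hi)
    have hn : interior (range (𝓡∂ n)) ∈ 𝓝 (extChartAt (𝓡∂ n) x x) :=
      isOpen_interior.mem_nhds hi
    have h1 : Tendsto (fun c : ℝ => extChartAt (𝓡∂ n) x x + c • ζ) (𝓝[>] 0)
        (𝓝 (extChartAt (𝓡∂ n) x x)) := by
      have : Continuous (fun c : ℝ => extChartAt (𝓡∂ n) x x + c • ζ) := by fun_prop
      simpa using (this.tendsto 0).mono_left nhdsWithin_le_nhds
    obtain ⟨c, hcr, hc0⟩ := ((h1.eventually hn).and self_mem_nhdsWithin).exists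
    exact ⟨c, hc0, interior_subset hcr⟩

end Boundary

/-! ### From the inequality at maxima to invariance in time -/

section Evolution

variable {M : Type*} [TopologicalSpace M] [CompactSpace M]
  {F : Type*} [NormedAddCommGroup F] [NormedSpace ℝ F]
  {V : M → Type*} [TopologicalSpace (TotalSpace F V)]
  [∀ x, NormedAddCommGroup (V x)] [∀ x, InnerProductSpace ℝ (V x)]
  [FiberBundle F V] [VectorBundle ℝ F V] [IsContinuousRiemannianBundle F V]
  {T : ℝ} {C : ℝ → Set (TotalSpace F V)} {f : ℝ → ∀ x : M, V x}

theorem isClosed_setOf_forall_mem_fiber (hCne : ∀ t ∈ Icc 0 T, ∀ x, (fiber (C t) x).Nonempty)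
    (hCclosed : ∀ t ∈ Icc 0 T, IsClosed (C t)) (hCcont : PointedHausdorffContinuousOn C (Icc 0 T))
    (hf : ContinuousOn (fun p : ℝ × M => TotalSpace.mk' F p.2 (f p.1 p.2)) (Icc 0 T ×ˢ univ)) :
    IsClosed ({t | ∀ x, f t x ∈ fiber (C t) x} ∩ Icc 0 T) := by
  refine isClosed_of_closure_subset fun t₀ ht₀ => ?_
  have ht : t₀ ∈ Icc 0 T := closure_minimal inter_subset_right isClosed_Icc ht₀
  refine ⟨fun x => ?_, ht⟩
  rw [mem_closure_iff_nhdsWithin_neBot] at ht₀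
  rw [(isClosed_fiber (hCclosed t₀ ht) x).mem_iff_infDist_zero (hCne t₀ ht x)]
  refine le_antisymm (le_of_forall_pos_le_add fun ε hε => ?_) Metric.infDist_nonneg
  have h1 := eventually_forall_norm_sub_lt hf ht (lt_min (half_pos hε) one_pos)
  have h2 := hCcont t₀ ht (‖f t₀ x‖ + 1) (by positivity) (ε / 2) (half_pos hε)
  have h3 := (h1.and h2).filter_mono
    (nhdsWithin_mono t₀ (inter_subset_right (s := {t | ∀ x, f t x ∈ fiber (C t) x})))
  obtain ⟨t, ⟨ht1, ht2⟩, hts, -⟩ := (h3.and self_mem_nhdsWithin).exists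
  have h4 := lt_min_iff.1 (ht1 x)
  have h5 := (ht2 x).1 (f t x) (hts x) (by
    have := norm_le_norm_add_norm_sub' (f t x) (f t₀ x)
    linarith [h4.2])
  have h6 := Metric.infDist_le_infDist_add_dist (s := fiber (C t₀) x) (x := f t₀ x) (y := f t x)
  rw [dist_comm, dist_eq_norm] at h6
  linarith [h4.1]

/-- For positive `w`, `d q * w q < c` means `d q < c / w q`; a number strictly between the two sides
at `p` separates them nearby, so the product is again upper semicontinuous. -/
theorem exists_isMaxOn_mul {X : Type*} [TopologicalSpace X] {d w : X → ℝ} {s : Set X}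
    (hs : IsCompact s) (hne : s.Nonempty) (hd : UpperSemicontinuousOn d s)
    (hw : ContinuousOn w s) (hw0 : ∀ p ∈ s, 0 < w p) :
    ∃ p ∈ s, ∀ q ∈ s, d q * w q ≤ d p * w p := by
  refine UpperSemicontinuousOn.exists_isMaxOn (f := fun p => d p * w p) hne hs ?_
  intro p hp c hc
  obtain ⟨m, hm1, hm2⟩ := exists_between ((lt_div_iff₀ (hw0 p hp)).2 hc)
  have h1 : ContinuousWithinAt (fun q => c / w q) s p :=
    continuousWithinAt_const.div (hw p hp) (hw0 p hp).ne'
  filter_upwards [hd p hp m hm1, h1.eventually (lt_mem_nhds hm2), self_mem_nhdsWithin]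
    with q hq1 hq2 hq
  exact (lt_div_iff₀ (hw0 q hq)).1 (hq1.trans hq2)

variable [FiniteDimensional ℝ F]

/-- A family of sections stays in an ODE-invariant family of sets if at the points of maximal
distance the velocity relative to the reaction term does not point outward. -/
theorem mem_fiber_of_inner_sub_nonpos {f' : ℝ → ∀ x : M, V x}
    {φ : ∀ x : M, V x → V x} (hφ : FiberwiseLocallyLipschitz F φ)
    (hCne : ∀ t ∈ Icc 0 T, ∀ x, (fiber (C t) x).Nonempty)
    (hCclosed : ∀ t ∈ Icc 0 T, IsClosed (C t)) (hCcont : PointedHausdorffContinuousOn C (Icc 0 T))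
    (hCconv : ∀ t ∈ Icc 0 T, ∀ x, Convex ℝ (fiber (C t) x)) (hCode : PreservedByODE φ C T)
    (hf : ContinuousOn (fun p : ℝ × M => TotalSpace.mk' F p.2 (f p.1 p.2)) (Icc 0 T ×ˢ univ))
    (hf' : ∀ t ∈ Icc 0 T, ∀ x, HasDerivWithinAt (fun s => f s x) (f' t x) (Icc 0 T) t)
    (hsemi : UpperSemicontinuousOn
      (fun p : ℝ × M => Metric.infDist (f p.1 p.2) (fiber (C p.1) p.2)) (Icc 0 T ×ˢ univ))
    (hineq : ∀ t ∈ Ioc 0 T, ∀ x : M,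
      (∀ y : M, Metric.infDist (f t y) (fiber (C t) y) ≤ Metric.infDist (f t x) (fiber (C t) x)) →
      0 < Metric.infDist (f t x) (fiber (C t) x) →
      ∀ v ∈ fiber (C t) x, dist (f t x) v = Metric.infDist (f t x) (fiber (C t) x) →
      inner ℝ (f' t x - φ x (f t x)) (f t x - v) ≤ 0)
    (h0 : ∀ x, f 0 x ∈ fiber (C 0) x) :
    ∀ t ∈ Icc 0 T, ∀ x, f t x ∈ fiber (C t) x := by
  -- Continuous induction: the good times form a closed set, so it remains to go a little beyond any
  -- good time `t₁ < T` before which the inclusion need not be known.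
  refine (isClosed_setOf_forall_mem_fiber hCne hCclosed hCcont hf).Icc_subset_of_forall_exists_gt
    h0 ?_
  rintro t₁ ⟨hs, ht₁⟩ t' ht'
  have ht₁' : t₁ ∈ Icc 0 T := ⟨ht₁.1, ht₁.2.le⟩
  have hσ : Continuous (fun x => TotalSpace.mk' F x (f t₁ x)) :=
    hf.comp_continuous (f := fun x : M => (t₁, x)) (by fun_prop) fun x => ⟨ht₁', mem_univ _⟩
  obtain ⟨L, δ, hδ, hL⟩ := hφ.exists_lipschitzOnWith_ball hσ
  have hdist : ∀ᶠ t in 𝓝[Icc 0 T] t₁, ∀ x, Metric.infDist (f t x) (fiber (C t) x) < δ / 4 :=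
    eventually_forall_of_eventually_prod
      (P := fun t x => Metric.infDist (f t x) (fiber (C t) x) < δ / 4) fun y =>
      hsemi (t₁, y) ⟨ht₁', mem_univ _⟩ (δ / 4) (by
        dsimp only
        rw [((isClosed_fiber (hCclosed t₁ ht₁') y).mem_iff_infDist_zero (hCne t₁ ht₁' y)).1 (hs y)]
        positivity)
  obtain ⟨η, hη, hηs⟩ := Metric.mem_nhdsWithin_iff.1
    ((eventually_forall_norm_sub_lt hf ht₁' (show (0 : ℝ) < δ / 4 by positivity)).and hdist)
  -- For `s - t₁ ≤ 1 / K` the weight `1 + K (s - t₁)` is at most `2`, so the resulting rate `k = K /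
  -- (1 + K (s - t₁))` is still at least `L + 1`.
  set K : ℝ := 2 * (L + 1) with hK
  have hK0 : 0 < K := by positivity
  set t₂ := min (min t' T) (min (t₁ + η / 2) (t₁ + 1 / K)) with ht₂
  have h12 : t₁ < t₂ := by
    refine lt_min (lt_min ht' ht₁.2) (lt_min (by linarith) ?_)
    have : 0 < 1 / K := by positivity
    linarith
  have h2t' : t₂ ≤ t' := (min_le_left _ _).trans (min_le_left _ _)
  have h2T : t₂ ≤ T := (min_le_left _ _).trans (min_le_right _ _)
  have h2η : t₂ ≤ t₁ + η / 2 := (min_le_right _ _).trans (min_le_left _ _)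
  have h2K : t₂ ≤ t₁ + 1 / K := (min_le_right _ _).trans (min_le_right _ _)
  have hsub : Icc t₁ t₂ ⊆ Icc 0 T := Icc_subset_Icc ht₁.1 h2T
  suffices h : ∀ t ∈ Icc t₁ t₂, ∀ x, f t x ∈ fiber (C t) x from
    ⟨t₂, h t₂ ⟨h12.le, le_rfl⟩, h12, h2t'⟩
  intro t ht x
  by_contra hx
  set d : ℝ × M → ℝ := fun p => Metric.infDist (f p.1 p.2) (fiber (C p.1) p.2) with hd
  have hpos : ∀ t ∈ Icc t₁ t₂, ∀ x, f t x ∉ fiber (C t) x → 0 < d (t, x) := fun t ht x h =>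
    ((isClosed_fiber (hCclosed t (hsub ht)) x).notMem_iff_infDist_pos (hCne t (hsub ht) x)).1 h
  have hw : ∀ t ∈ Icc t₁ t₂, 0 < 1 + K * (t - t₁) := fun t ht => by
    have := mul_nonneg hK0.le (sub_nonneg.2 ht.1)
    linarith
  -- Maximizing the quotient of `d` by the weight makes `z` a spatial maximum at time `s` and bounds
  -- the distance at earlier times by a factor that is affine in time.
  obtain ⟨⟨s, z⟩, ⟨hs', -⟩, hmax⟩ := exists_isMaxOn_mul (d := d)
    (w := fun p : ℝ × M => (1 + K * (p.1 - t₁))⁻¹) (s := Icc t₁ t₂ ×ˢ (univ : Set M))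
    (isCompact_Icc.prod isCompact_univ) ⟨(t, x), ht, mem_univ _⟩
    (fun p hp c hc => (hsemi p ⟨hsub hp.1, mem_univ _⟩ c hc).filter_mono
      (nhdsWithin_mono _ (prod_mono_left hsub)))
    (ContinuousOn.inv₀ (by fun_prop) fun p hp => (hw p.1 hp.1).ne')
    (fun p hp => inv_pos.2 (hw p.1 hp.1))
  have hdz : 0 < d (s, z) := by
    have h1 := hmax (t, x) ⟨ht, mem_univ _⟩
    have h2 := mul_pos (hpos t ht x hx) (inv_pos.2 (hw t ht))
    exact (mul_pos_iff_of_pos_right (inv_pos.2 (hw s hs'))).1 (h2.trans_le h1)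
  have hle : ∀ τ ∈ Icc t₁ t₂, ∀ y,
      d (τ, y) ≤ (1 + K * (τ - t₁)) / (1 + K * (s - t₁)) * d (s, z) := by
    intro τ hτ y
    have h1 := hmax (τ, y) ⟨hτ, mem_univ _⟩
    simp only at h1
    rw [← div_eq_mul_inv, ← div_eq_mul_inv, div_le_iff₀ (hw τ hτ)] at h1
    refine h1.trans_eq ?_
    ring
  have ht₁s : t₁ < s := by
    refine lt_of_le_of_ne hs'.1 ?_
    rintro rfl
    have h1 := ((isClosed_fiber (hCclosed t₁ ht₁') z).mem_iff_infDist_zero (hCne t₁ ht₁' z)).1 (hs z)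
    exact hdz.ne' h1
  have hsT : s ∈ Icc 0 T := hsub hs'
  set k := K / (1 + K * (s - t₁)) with hk
  have hk1 : (L : ℝ) + 1 ≤ k := by
    rw [hk, le_div_iff₀ (hw s hs')]
    have h1 : K * (s - t₁) ≤ 1 := by
      have h2 : s - t₁ ≤ 1 / K := by linarith [hs'.2]
      calc K * (s - t₁) ≤ K * (1 / K) := by gcongr
        _ = 1 := by field_simp
    have hL0 : (0 : ℝ) ≤ L := L.2
    rw [hK] at h1 ⊢
    nlinarith
  have := finiteDimensional_fiber F (V := V) z
  have : ProperSpace (V z) := FiniteDimensional.proper ℝ (V z)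
  obtain ⟨v, hv, hvd⟩ := (isClosed_fiber (hCclosed s hsT) z).exists_infDist_eq_dist
    (hCne s hsT z) (f s z)
  have hnear := hηs ⟨by
    rw [Metric.mem_ball, Real.dist_eq, abs_of_pos (by linarith)]
    linarith [hs'.2], hsT⟩
  have hfz : dist (f s z) (f t₁ z) < δ / 4 := by
    rw [dist_eq_norm]; exact hnear.1 z
  have hvz : dist v (f t₁ z) < δ / 2 := by
    have h1 := dist_triangle v (f s z) (f t₁ z)
    rw [dist_comm v (f s z), ← hvd] at h1
    linarith [hnear.2 z]
  -- Since `v` is within `δ / 2` of `f t₁ z`, this ball lies in the tube on which `φ z` has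
  -- Lipschitz constant `L`.
  have hball : Metric.closedBall v (δ / 4) ⊆ Metric.ball (f t₁ z) δ := by
    intro p hp
    rw [Metric.mem_closedBall] at hp
    rw [Metric.mem_ball]
    linarith [dist_triangle p v (f t₁ z)]
  have hIcc : Icc t₁ s ⊆ Icc 0 T := (Icc_subset_Icc_right hs'.2).trans hsub
  have hkey := mul_sq_le_inner_of_preserved (S := fun τ => fiber (C τ) z) (φ := φ z)
    (a := fun τ => f τ z) (a' := f' s z) (v := v) (k := k) ht₁s
    (by linarith [L.2])
    (fun τ hτ => hCne τ (hIcc hτ) z) (fun τ hτ => isClosed_fiber (hCclosed τ (hIcc hτ)) z)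
    (inner_nearest_nonpos (hCconv s hsT z) hv hvd.symm) hvd.symm
    ((hf' s hsT z).mono hIcc)
    (fun R hR ε hε => ((hCcont s hsT R hR ε hε).filter_mono (nhdsWithin_mono _ hIcc)).mono
      fun τ hτ p hp hpR => (hτ z).1 p hp hpR)
    (show 0 < δ / 4 by positivity) ((hL z).mono hball)
    (fun τ hτ c hc hcτ => hCode z τ s (hIcc hτ).1 hτ.2 hsT.2 c hc hcτ)
    (fun τ hτ => by
      refine (hle τ ⟨hτ.1, hτ.2.trans hs'.2⟩ z).trans_eq ?_
      have h1 : (1 + K * (τ - t₁)) / (1 + K * (s - t₁)) = 1 - k * (s - τ) := by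
        rw [hk]
        have := (hw s hs').ne'
        field_simp
        ring
      rw [h1])
  have hreact := hineq s ⟨ht₁.1.trans_lt ht₁s, hsT.2⟩ z (fun y => by
      have h1 := hle s hs' y
      rwa [div_self (hw s hs').ne', one_mul] at h1) hdz v hv hvd.symm
  have hlip : ‖φ z (f s z) - φ z v‖ ≤ L * dist (f s z) v := by
    rw [← dist_eq_norm]
    exact (hL z).dist_le_mul _ (by rw [Metric.mem_ball]; linarith) _
      (by rw [Metric.mem_ball]; linarith)
  have hdv : 0 < dist (f s z) v := by rw [← hvd]; exact hdz
  -- Passing from `φ z v` to `φ z (f s z)` costs at most `L` times the squared distance. As `k ≥ L +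
  -- 1`, the left side of `hreact` would be at least the squared distance, which is positive.
  have h1 : inner ℝ (f' s z - φ z v) (f s z - v) =
      inner ℝ (f' s z - φ z (f s z)) (f s z - v) + inner ℝ (φ z (f s z) - φ z v) (f s z - v) := by
    rw [← inner_add_left, sub_add_sub_cancel]
  have h2 := real_inner_le_norm (φ z (f s z) - φ z v) (f s z - v)
  rw [← dist_eq_norm (f s z)] at h2
  have h3 := mul_le_mul_of_nonneg_right hlip hdv.le
  have h4 := mul_le_mul_of_nonneg_right hk1 (sq_nonneg (dist (f s z) v))
  have h5 := pow_pos hdv 2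
  nlinarith

end Evolution

/-! ### Restricting the smooth family to fixed time or fixed point -/

section Family

variable {E : Type*} [NormedAddCommGroup E] [NormedSpace ℝ E]
  {H : Type*} [TopologicalSpace H] {I : ModelWithCorners ℝ E H}
  {M : Type*} [TopologicalSpace M] [ChartedSpace H M]
  {F : Type*} [NormedAddCommGroup F] [NormedSpace ℝ F]
  {V : M → Type*} [TopologicalSpace (TotalSpace F V)]
  [∀ x, NormedAddCommGroup (V x)] [∀ x, InnerProductSpace ℝ (V x)]
  [FiberBundle F V] [VectorBundle ℝ F V] {J : Set ℝ} {f : ℝ → ∀ x : M, V x} {t : ℝ}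

omit [∀ x, InnerProductSpace ℝ (V x)] [VectorBundle ℝ F V] in
theorem contMDiff_section_of_family
    (hf : ContMDiffOn (𝓘(ℝ, ℝ).prod I) (I.prod 𝓘(ℝ, F)) ∞
      (fun p : ℝ × M => TotalSpace.mk' F p.2 (f p.1 p.2)) (J ×ˢ univ)) (ht : t ∈ J) :
    ContMDiff I (I.prod 𝓘(ℝ, F)) ∞ (fun x => TotalSpace.mk' F x (f t x)) := by
  have h1 : ContMDiff I (𝓘(ℝ, ℝ).prod I) ∞ (fun x : M => (t, x)) :=
    contMDiff_const.prodMk contMDiff_id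
  rw [← contMDiffOn_univ] at h1 ⊢
  exact hf.comp h1 fun x _ => ⟨ht, mem_univ x⟩

theorem differentiableWithinAt_section_of_family
    (hf : ContMDiffOn (𝓘(ℝ, ℝ).prod I) (I.prod 𝓘(ℝ, F)) ∞
      (fun p : ℝ × M => TotalSpace.mk' F p.2 (f p.1 p.2)) (J ×ˢ univ)) (ht : t ∈ J) (x : M) :
    DifferentiableWithinAt ℝ (fun s => f s x) J t := by
  have h1 : ContMDiff 𝓘(ℝ, ℝ) (𝓘(ℝ, ℝ).prod I) ∞ (fun s : ℝ => (s, x)) :=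
    contMDiff_id.prodMk contMDiff_const
  have h2 : ContMDiffWithinAt 𝓘(ℝ, ℝ) (I.prod 𝓘(ℝ, F)) ∞
      (fun s : ℝ => TotalSpace.mk' F x (f s x)) J t :=
    ContMDiffWithinAt.comp (f := fun s : ℝ => (s, x)) (s := J) t (hf (t, x) ⟨ht, mem_univ x⟩)
      h1.contMDiffAt.contMDiffWithinAt fun s hs => ⟨hs, mem_univ x⟩
  have h3 := (contMDiffWithinAt_totalSpace.1 h2).2
  have h4 : DifferentiableWithinAt ℝ
      (fun s => (trivializationAt F V x (TotalSpace.mk' F x (f s x))).2) J t :=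
    h3.contDiffWithinAt.differentiableWithinAt (by simp)
  have hx : x ∈ (trivializationAt F V x).baseSet := mem_baseSet_trivializationAt F V x
  have h5 := (ofCoord x x : F →L[ℝ] V x).differentiableAt.comp_differentiableWithinAt t h4
  refine h5.congr_of_eventuallyEq_of_mem (Eventually.of_forall fun s => ?_) ht
  simp only [Function.comp]
  rw [← toCoord_apply hx, ofCoord_toCoord hx]

end Family

/-! ### Vanishing of the normal component of the first derivative -/

section HalfSpace

variable {n : ℕ} [NeZero n] {M : Type*} [TopologicalSpace M] [T2Space M]
    [ChartedSpace (EuclideanHalfSpace n) M] [IsManifold (𝓡∂ n) ∞ M]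
    {F : Type*} [NormedAddCommGroup F] [NormedSpace ℝ F] [FiniteDimensional ℝ F]
    {V : M → Type*} [TopologicalSpace (TotalSpace F V)]
    [∀ x, NormedAddCommGroup (V x)] [∀ x, InnerProductSpace ℝ (V x)]
    [FiberBundle F V] [VectorBundle ℝ F V] [ContMDiffVectorBundle ∞ F V (𝓡∂ n)]
    [IsContMDiffRiemannianBundle (𝓡∂ n) 1 F V]
    {D : CovariantDerivative (𝓡∂ n) F V} {S : Set (TotalSpace F V)} {x : M}

theorem inner_nonpos_of_mem_tangentCone {W : Type*} [NormedAddCommGroup W] [InnerProductSpace ℝ W]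
    {S : Set W} {u v ξ : W} (hu : u ∉ S) (hd : dist u v = Metric.infDist u S)
    (hξ : ξ ∈ tangentCone S v) : inner ℝ ξ (u - v) ≤ 0 := by
  have h := hξ u hu hd
  rw [← neg_sub, inner_neg_right] at h
  linarith

/-- At a maximum of the distance, the derivative is orthogonal to the normal of the fibre, if the
boundary condition holds. -/
theorem inner_covDeriv_eq_zero_of_max (hD : ContMDiffCovariantDerivativeOn F ∞ D.toFun univ)
    (hDm : D.IsMetricCompatible) (hS : ParallelInvariant D S) (hne : ∀ x, (fiber S x).Nonempty)
    (hconv : Convex ℝ (fiber S x)) {σ : ∀ y, V y}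
    (hσ : ContMDiff (𝓡∂ n) ((𝓡∂ n).prod 𝓘(ℝ, F)) ∞ (fun y => TotalSpace.mk' F y (σ y)))
    (hmax : ∀ y, Metric.infDist (σ y) (fiber S y) ≤ Metric.infDist (σ x) (fiber S x))
    {v : V x} (hv : v ∈ fiber S x) (hd : dist (σ x) v = Metric.infDist (σ x) (fiber S x))
    (hσx : σ x ∉ fiber S x)
    (g : ContMDiffRiemannianMetric (𝓡∂ n) ∞ (EuclideanSpace ℝ (Fin n))
      (fun x : M => TangentSpace (𝓡∂ n) x))
    (hbdry : x ∈ (𝓡∂ n).boundary M → ∀ ν : TangentSpace (𝓡∂ n) x, IsExteriorUnitNormal g x ν →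
      D σ x ν ∈ tangentCone (fiber S x) v) (X : TangentSpace (𝓡∂ n) x) :
    inner ℝ (D σ x X) (σ x - v) = 0 := by
  have hxs := mem_chart_source (EuclideanHalfSpace n) x
  set lam : EuclideanSpace ℝ (Fin n) →ₗ[ℝ] ℝ :=
    { toFun := fun ζ => inner ℝ (D σ x (coordVec x ζ x)) (σ x - v)
      map_add' := fun a b => by simp [coordVec, inner_add_left]
      map_smul' := fun c a => by simp [coordVec, real_inner_smul_left] } with hlam
  have hle : ∀ ζ : EuclideanSpace ℝ (Fin n), 0 ≤ ζ 0 ∨ x ∉ (𝓡∂ n).boundary M → lam ζ ≤ 0 := by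
    intro ζ hζ
    obtain ⟨ε, hε, h⟩ := exists_add_smul_mem_range x ζ hζ
    exact inner_covDeriv_nonpos_of_max hD hDm hS hne hconv hσ hmax hv hd hε h
  suffices h : ∀ ζ, lam ζ = 0 by
    obtain ⟨ζ, rfl⟩ := exists_coordVec_eq hxs X
    exact h ζ
  intro ζ
  by_cases hx : x ∈ (𝓡∂ n).boundary M
  · obtain ⟨ν, hν⟩ := exists_isExteriorUnitNormal g x
    obtain ⟨η, rfl⟩ := exists_coordVec_eq hxs ν
    have hη0 : η 0 < 0 := by
      have := hν.exterior
      rwa [mvfderiv_extChartAt_coordVec] at this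
    -- The boundary condition gives one sign for the exterior normal `η`; maximality in the inward
    -- direction `-η` gives the other.
    have hη : lam η = 0 := by
      refine le_antisymm (inner_nonpos_of_mem_tangentCone hσx hd (hbdry hx _ hν)) ?_
      have h1 := hle (-η) (Or.inl (by simpa using hη0.le))
      rw [map_neg] at h1
      linarith
    have htan : ∀ ξ : EuclideanSpace ℝ (Fin n), ξ 0 = 0 → lam ξ = 0 := by
      intro ξ hξ
      have h1 := hle ξ (Or.inl hξ.ge)
      have h2 := hle (-ξ) (Or.inl (by simp [hξ]))
      rw [map_neg] at h2
      linarith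
    -- Subtracting this multiple of the normal leaves a vector tangent to the boundary, where both
    -- signs of the direction are admissible.
    have h1 := htan (ζ - (ζ 0 / η 0) • η) (by simp [hη0.ne])
    rwa [map_sub, map_smul, hη, smul_zero, sub_zero] at h1
  · have h1 := hle ζ (Or.inr hx)
    have h2 := hle (-ζ) (Or.inr hx)
    rw [map_neg] at h2
    linarith

end HalfSpace

end TensorMaxPrinciple

end

/-! ### The maximum principle -/

open TensorMaxPrinciple in
theorem theorem2p1
    -- a compact smooth manifold with boundary
    {n : ℕ} [NeZero n] {M : Type*} [TopologicalSpace M] [T2Space M] [CompactSpace M]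
    [ChartedSpace (EuclideanHalfSpace n) M] [IsManifold (𝓡∂ n) ∞ M]
    -- a smooth vector bundle of finite rank with a smooth metric
    {F : Type*} [NormedAddCommGroup F] [NormedSpace ℝ F] [FiniteDimensional ℝ F]
    {V : M → Type*} [TopologicalSpace (TotalSpace F V)]
    [∀ x, NormedAddCommGroup (V x)] [∀ x, InnerProductSpace ℝ (V x)]
    [FiberBundle F V] [VectorBundle ℝ F V] [ContMDiffVectorBundle ∞ F V (𝓡∂ n)]
    [IsContMDiffRiemannianBundle (𝓡∂ n) ∞ F V]
    (T : ℝ) (hT : 0 < T)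
    -- time-dependent Riemannian metrics on `M` with their Levi-Civita connections
    (g : ℝ → ContMDiffRiemannianMetric (𝓡∂ n) ∞ (EuclideanSpace ℝ (Fin n))
      (fun x : M => TangentSpace (𝓡∂ n) x))
    (nabla : ℝ → CovariantDerivative (𝓡∂ n) (EuclideanSpace ℝ (Fin n))
      (fun x : M => TangentSpace (𝓡∂ n) x))
    (hnabla : ∀ t ∈ Icc 0 T, IsLeviCivita (g t) (nabla t))
    -- time-dependent smooth metric connections on `V`
    (D : ℝ → CovariantDerivative (𝓡∂ n) F V)
    (hDsmooth : ∀ t ∈ Icc 0 T, ContMDiffCovariantDerivativeOn F ∞ (D t).toFun univ)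
    (hDmetric : ∀ t ∈ Icc 0 T, (D t).IsMetricCompatible)
    -- the reaction term
    (φ : ∀ x : M, V x → V x) (hφ : FiberwiseLocallyLipschitz F φ)
    -- the family of subsets
    (C : ℝ → Set (TotalSpace F V))
    (hCne : ∀ t ∈ Icc 0 T, ∀ x, (fiber (C t) x).Nonempty)
    (hCclosed : ∀ t ∈ Icc 0 T, IsClosed (C t))
    (hCcont : PointedHausdorffContinuousOn C (Icc 0 T))
    (hCpar : ∀ t ∈ Icc 0 T, ParallelInvariant (D t) (C t))
    (hCconv : ∀ t ∈ Icc 0 T, ∀ x, Convex ℝ (fiber (C t) x))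
    (hCode : PreservedByODE φ C T)
    -- a smooth family of sections
    (f : ℝ → ∀ x : M, V x)
    (hf : ContMDiffOn (𝓘(ℝ, ℝ).prod (𝓡∂ n)) ((𝓡∂ n).prod 𝓘(ℝ, F)) ∞
      (fun p : ℝ × M => TotalSpace.mk' F p.2 (f p.1 p.2)) (Icc 0 T ×ˢ univ))
    -- the differential relation at extremal points
    (hpde : ∀ t ∈ Ioc 0 T, ∀ x : M,
      (∀ y : M, Metric.infDist (f t y) (fiber (C t) y) ≤ Metric.infDist (f t x) (fiber (C t) x)) →
      0 < Metric.infDist (f t x) (fiber (C t) x) →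
      ∀ v ∈ fiber (C t) x, dist (f t x) v = Metric.infDist (f t x) (fiber (C t) x) →
      ∃ (k l : ℕ) (X : Fin k → ∀ y : M, TangentSpace (𝓡∂ n) y)
        (Y : Fin l → ∀ y : M, TangentSpace (𝓡∂ n) y) (U : Set M), IsOpen U ∧ x ∈ U ∧
        (∀ i, ContMDiffOn (𝓡∂ n) (𝓡∂ n).tangent ∞
          (fun y => (⟨y, X i y⟩ : TangentBundle (𝓡∂ n) M)) U) ∧
        (∀ j, ContMDiffOn (𝓡∂ n) (𝓡∂ n).tangent ∞
          (fun y => (⟨y, Y j y⟩ : TangentBundle (𝓡∂ n) M)) U) ∧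
        derivWithin (fun s => f s x) (Icc 0 T) t
            - ∑ i, secondCovDeriv (D t) (nabla t) (X i) (f t) x
            - ∑ j, D t (f t) x (Y j x) - φ x (f t x)
          ∈ tangentCone (fiber (C t) x) v)
    -- the boundary condition at extremal points
    (hbdry : ∀ t ∈ Icc 0 T, ∀ x ∈ (𝓡∂ n).boundary M,
      (∀ y : M, Metric.infDist (f t y) (fiber (C t) y) ≤ Metric.infDist (f t x) (fiber (C t) x)) →
      0 < Metric.infDist (f t x) (fiber (C t) x) →
      ∀ v ∈ fiber (C t) x, dist (f t x) v = Metric.infDist (f t x) (fiber (C t) x) →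
      ∀ ν : TangentSpace (𝓡∂ n) x, IsExteriorUnitNormal (g t) x ν →
        D t (f t) x ν ∈ tangentCone (fiber (C t) x) v)
    (h0 : ∀ x, f 0 x ∈ fiber (C 0) x) :
    ∀ t ∈ Icc 0 T, ∀ x, f t x ∈ fiber (C t) x := by
  have hR1 : IsContMDiffRiemannianBundle (𝓡∂ n) 1 F V :=
    IsContMDiffRiemannianBundle.of_le (n := ∞) (by simp)
  have hR : IsContinuousRiemannianBundle F V := isContinuousRiemannianBundle hR1
  refine mem_fiber_of_inner_sub_nonpos
    (f' := fun t x => derivWithin (fun s => f s x) (Icc 0 T) t) hφ hCne hCclosed hCcont hCconv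
    hCode hf.continuousOn
    (fun t ht x => (differentiableWithinAt_section_of_family hf ht x).hasDerivWithinAt)
    (fun p hp => upperSemicontinuousWithinAt_infDist hCcont hp.1 (hDsmooth _ hp.1)
      (hDmetric _ hp.1) (hCpar _ hp.1) (hCne _ hp.1 _) (isClosed_fiber (hCclosed _ hp.1) _)
      hf.continuousOn) (fun t ht x hmax hpos v hv hd => ?_) h0
  have ht' : t ∈ Icc 0 T := Ioc_subset_Icc_self ht
  have hσ := contMDiff_section_of_family hf ht'
  have hfx : f t x ∉ fiber (C t) x :=
    ((isClosed_fiber (hCclosed t ht') x).notMem_iff_infDist_pos (hCne t ht' x)).2 hpos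
  have hN := inner_covDeriv_eq_zero_of_max (hDsmooth t ht') (hDmetric t ht') (hCpar t ht')
    (hCne t ht') (hCconv t ht' x) hσ hmax hv hd hfx (g t)
    (fun hx ν hν => hbdry t ht' x hx hmax hpos v hv hd ν hν)
  obtain ⟨k, l, X, Y, U, hU, hxU, hX, hY, hcone⟩ := hpde t ht x hmax hpos v hv hd
  have h1 := inner_nonpos_of_mem_tangentCone hfx hd hcone
  have h2 : ∀ i, inner ℝ (secondCovDeriv (D t) (nabla t) (X i) (f t) x) (f t x - v) ≤ 0 := fun i =>
    inner_secondCovDeriv_nonpos_of_max (hDsmooth t ht') (hDmetric t ht') (hCpar t ht')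
      (hCne t ht') (hCconv t ht' x) hσ hmax hv hd hN
      -- Of `ζ` and `-ζ` at least one has nonnegative zeroth coordinate and so stays in the
      -- half-space, also at boundary points.
      (fun ζ => by
        rcases le_total 0 (ζ 0) with h | h
        · obtain ⟨ε, hε, h⟩ := exists_add_smul_mem_range x ζ (Or.inl h)
          exact ⟨ε, hε, Or.inl h⟩
        · obtain ⟨ε, hε, h⟩ := exists_add_smul_mem_range x (-ζ) (Or.inl (by simpa using h))
          exact ⟨ε, hε, Or.inr h⟩)
      (nabla t) ((hX i).contMDiffAt (hU.mem_nhds hxU))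
  have h3 : inner ℝ (∑ i, secondCovDeriv (D t) (nabla t) (X i) (f t) x) (f t x - v) ≤ 0 := by
    rw [sum_inner]
    exact Finset.sum_nonpos fun i _ => h2 i
  have h4 : inner ℝ (∑ j, D t (f t) x (Y j x)) (f t x - v) = 0 := by
    rw [sum_inner]
    exact Finset.sum_eq_zero fun j _ => hN _
  -- In the cone inequality the second order sum has nonpositive normal component and the first
  -- order sum has none, so `⟪∂ₜf - φ(f), f - v⟫ ≤ 0` remains.
  rw [inner_sub_left, inner_sub_left, inner_sub_left, h4] at h1
  rw [inner_sub_left]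
  linarith
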